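/- Let $\theta,\sigma,\lambda\in PC^1[0,1]$ with $\inf_{[0,1]}\theta>0$, and let $\alpha_0,\beta_0,\alpha_1,\beta_1\in\mathbb R$ with $(\alpha_0,\beta_0)\neq(0,0)$ and $(\alpha_1,\beta_1)\ne(0,0)$. Here $\psi\in PC^k[0,1]$ means that $[0,1]$ is a finite disjoint union of intervals (single points allowed) on each of which $\psi$ is the restriction of a $C^k[0,1]$ function, and $\psi\in PC^{(2),1}[0,1]$ means $\psi\in C^1[0,1]\cap H^2(0,1)$ with $\psi_{xx}\in PC^1[0,1]$ (up to a null set). For $w\in H^2(0,1)$ let $\mathcal A w=\theta w_{xx}+\sigma w_x+\lambda w$, and let $$\mathcal D(\mathcal A)=\{w\in H^2(0,1):\ \alpha_0w_x(0)+\beta_0w(0)=0,\ \alpha_1w_x(1)+\beta_1w(1)=0\}.$$ Functions in $H^2(0,1)$ are identified with their $C^1[0,1]$ representatives. Let $T>0$ and let $u_0,u_T\in PC^{(2),1}[0,1]$ satisfy $\alpha_0u_{0,x}(0)+\beta_0u_0(0)=0$ and $\alpha_0u_{T,x}(0)+\beta_0u_T(0)=0$. Suppose that $\mathcal A^ku_0$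 and $\mathcal A^ku_T$ belong to $\mathcal D(\mathcal A)$ for all $k\ge1$ and that, for some constants $C_0,C_T>0$, $$\|\mathcal A^ku_0\|_{L^2(0,1)}\le C_0^k\,k!,\qquad \|\mathcal A^ku_T\|_{L^2(0,1)}\le C_T^k\,k!\qquad\text{for all }k\ge1 .$$ Let $1<\alpha<2$ and let $y:[0,T]\to\mathbb R$ be a smooth function of Gevrey order $\alpha$, i.e. $\sup_{t\in[0,T]}|y^{(m)}(t)|\le D^{m+1}(m!)^\alpha$ for some $D>0$ and all $m\ge0$, such that for all $m\ge0$ $$y^{(m)}(0)=\alpha_0\,\mathcal A^mu_0(0)-\beta_0(\mathcal A^mu_0)_x(0),\qquad y^{(m)}(T)=\alpha_0\,\mathcal A^mu_T(0)-\beta_0(\mathcal A^mu_T)_x(0).$$ For $n\ge1$ put $h=1/(n+1)$, $r_0=\alpha_0/(3\alpha_0-2h\beta_0)$ and $q_0=-\beta_0/(\alpha_0-h\beta_0)$ (well defined for all sufficiently large $n$), and define functions $v_{n,1},\dots,v_{n,n}$ on $[0,T]$ by $$v_{n,1}=\frac{y}{\alpha_0-q_0\beta_0},\qquad v_{n,2}=\frac{h^2}{(1-r_0)\theta(h)}\,\dot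 v_{n,1}-\frac{h^2[\sigma(h)q_0+\lambda(h)]+(4r_0-2)\theta(h)}{(1-r_0)\theta(h)}\,v_{n,1},$$ $$v_{n,j+1}=\frac{h^2}{\theta(jh)}\,\dot v_{n,j}+\frac{h\sigma(jh)-\theta(jh)}{\theta(jh)}\,v_{n,j-1}+\frac{2\theta(jh)-h\sigma(jh)-h^2\lambda(jh)}{\theta(jh)}\,v_{n,j}\qquad(2\le j\le n-1).$$ Let $v_n(t)=(v_{n,1}(t),\dots,v_{n,n}(t))\in\mathbb R^n$, let $R_nz=(z(h),z(2h),\dots,z(nh))$ for a function $z$ on $[0,1]$, and let $\|v\|_{2d}=\big(h\sum_{j=1}^n|v_j|^2\big)^{1/2}$ for $v\in\mathbb R^n$. Then $$\lim_{n\to\infty}\|R_nu_0-v_n(0)\|_{2d}=0,\qquad \lim_{n\to\infty}\|R_nu_T-v_n(T)\|_{2d}=0 .$$ -/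

import Mathlib

open MeasureTheory Set Filter Topology
open scoped ContDiff Nat

noncomputable section

namespace ParabolicFlat

/-- The space interval `[0,1]`. -/
def unitI : Set ℝ := Icc (0 : ℝ) 1

/-- The spatial derivative `w_x` on `[0,1]` (one-sided at the end points). -/
def dx (w : ℝ → ℝ) : ℝ → ℝ := derivWithin w unitI

/-- Lebesgue measure on `(0,1)`. -/
def vol01 : Measure ℝ := volume.restrict (Ioo (0 : ℝ) 1)

/-- `ψ ∈ PC^k[0,1]`: there is a finite partition of `[0,1]` into disjoint intervals (order-connected
sets of reals) on each of which `ψ` is the restriction of some function in `C^k[0,1]`. -/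
def IsPC (k : ℕ) (ψ : ℝ → ℝ) : Prop :=
  ∃ F : Finset (Set ℝ),
    (∀ J ∈ F, J.OrdConnected) ∧
    (F : Set (Set ℝ)).PairwiseDisjoint id ∧
    (⋃ J ∈ F, J) = unitI ∧
    ∀ J ∈ F, ∃ g : ℝ → ℝ, ContDiffOn ℝ k g unitI ∧ EqOn ψ g J

/-- `w ∈ H²(0,1)`, for the continuous representative `w` on `[0,1]`: `w` is `C¹`, its derivative is
absolutely continuous, and the (almost everywhere existing) second derivative is in `L²(0,1)`. -/
structure IsH2 (w : ℝ → ℝ) : Prop where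
  contDiffOn : ContDiffOn ℝ 1 w unitI
  absCont : AbsolutelyContinuousOnInterval (dx w) 0 1
  memLp : MemLp (dx (dx w)) 2 vol01

/-- `ψ ∈ PC^{(2),1}[0,1]`: `ψ ∈ C¹[0,1] ∩ H²(0,1)` and `ψ_xx`, which is defined almost everywhere,
is in `PC¹[0,1]`. -/
def IsPC21 (ψ : ℝ → ℝ) : Prop :=
  IsH2 ψ ∧ ∃ g : ℝ → ℝ, IsPC 1 g ∧ dx (dx ψ) =ᵐ[vol01] g

open Classical in
/-- The representative of the class of `g` modulo null sets of `(0,1)` which is continuous on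
`[0,1]`, if there is one (it is then unique on `[0,1]`); otherwise `g` itself. -/
def contRep (g : ℝ → ℝ) : ℝ → ℝ :=
  if H : ∃ f : ℝ → ℝ, ContinuousOn f unitI ∧ f =ᵐ[vol01] g then H.choose else g

/-- The coefficients of `u_t = θ u_xx + σ u_x + lam u` and of the boundary conditions
`α₀ u_x(0,t) + β₀ u(0,t) = 0`, `α₁ u_x(1,t) + β₁ u(1,t) = f(t)`. -/
structure Coeffs where
  θ : ℝ → ℝ
  σ : ℝ → ℝ
  lam : ℝ → ℝ
  α₀ : ℝ
  β₀ : ℝ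
  α₁ : ℝ
  β₁ : ℝ

namespace Coeffs

/-- Standing assumptions on the coefficients: `θ, σ, lam ∈ PC¹[0,1]`, `inf θ > 0`, and neither
boundary condition is void. -/
structure Admissible (P : Coeffs) : Prop where
  θ_pc : IsPC 1 P.θ
  σ_pc : IsPC 1 P.σ
  lam_pc : IsPC 1 P.lam
  θ_pos : ∃ c : ℝ, 0 < c ∧ ∀ x ∈ unitI, c ≤ P.θ x
  bc₀ : P.α₀ ≠ 0 ∨ P.β₀ ≠ 0
  bc₁ : P.α₁ ≠ 0 ∨ P.β₁ ≠ 0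

/-- The differential expression `𝒜 w = θ w_xx + σ w_x + lam w`, defined almost everywhere on
`(0,1)` for `w ∈ H²(0,1)`. -/
def opA (P : Coeffs) (w : ℝ → ℝ) : ℝ → ℝ :=
  fun x => P.θ x * dx (dx w) x + P.σ x * dx w x + P.lam x * w x

/-- `w ∈ 𝒟(𝒜)`: `w ∈ H²(0,1)` with the homogeneous boundary conditions. -/
structure InDomain (P : Coeffs) (w : ℝ → ℝ) : Prop where
  h2 : IsH2 w
  left : P.α₀ * dx w 0 + P.β₀ * w 0 = 0
  right : P.α₁ * dx w 1 + P.β₁ * w 1 = 0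

/-- `𝒜^k u`. As `𝒜 w` is only defined almost everywhere, its continuous representative is taken
(when there is one, as is the case when `𝒜 w ∈ H²(0,1)`) before `𝒜` is applied again or point
values are read off. -/
def powA (P : Coeffs) : ℕ → (ℝ → ℝ) → (ℝ → ℝ)
  | 0, u => u
  | k + 1, u => contRep (P.opA (powA P k u))

/-- The requirements of the motion planning problem on an initial or final state `u`:
`u ∈ PC^{(2),1}[0,1]` satisfies the boundary condition at `0`, and for all `k ≥ 1` the function
`𝒜^k u` is in `𝒟(𝒜)` with `‖𝒜^k u‖_{L²} ≤ C^k k!`, for some `C > 0`.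
The function `u` itself need not satisfy a boundary condition at `1`. -/
structure IsState (P : Coeffs) (u : ℝ → ℝ) : Prop where
  pc21 : IsPC21 u
  left : P.α₀ * dx u 0 + P.β₀ * u 0 = 0
  domain : ∀ k : ℕ, 1 ≤ k → P.InDomain (P.powA k u)
  bound : ∃ C : ℝ, 0 < C ∧ ∀ k : ℕ, 1 ≤ k →
    eLpNorm (P.powA k u) 2 vol01 ≤ ENNReal.ofReal (C ^ k * (k ! : ℝ))

/-- `α₀ 𝒜^m u(0) - β₀ (𝒜^m u)_x(0)`. -/
def endpointValue (P : Coeffs) (m : ℕ) (u : ℝ → ℝ) : ℝ :=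
  P.α₀ * P.powA m u 0 - P.β₀ * dx (P.powA m u) 0

end Coeffs

/-- The Gevrey class `G_α[0,T]`; the derivatives are those on `[0,T]`, one-sided at the ends. -/
def IsGevrey (α T : ℝ) (y : ℝ → ℝ) : Prop :=
  ContDiffOn ℝ ∞ y (Icc 0 T) ∧
  ∃ D : ℝ, 0 < D ∧ ∀ m : ℕ, ∀ t ∈ Icc 0 T,
    |iteratedDerivWithin m y (Icc 0 T) t| ≤ D ^ (m + 1) * (m ! : ℝ) ^ α

/-- The step size `h = 1/(n+1)`. -/
def step (n : ℕ) : ℝ := 1 / ((n : ℝ) + 1)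

/-- The norm `‖v‖_{2d} = √h ‖v‖₂` on `ℝⁿ`. -/
def norm2d {n : ℕ} (v : Fin n → ℝ) : ℝ := √(step n) * √(∑ i, (v i) ^ 2)

/-- `R_n z = [z(h), z(2h), …, z(nh)]`. -/
def sample (n : ℕ) (z : ℝ → ℝ) : Fin n → ℝ := fun i => z (((i : ℕ) + 1 : ℝ) * step n)

namespace Coeffs

/-- `r₀ = α₀ / (3 α₀ - 2 h β₀)`. -/
def r₀ (P : Coeffs) (n : ℕ) : ℝ := P.α₀ / (3 * P.α₀ - 2 * step n * P.β₀)

/-- `q₀ = -β₀ / (α₀ - h β₀)`. -/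
def q₀ (P : Coeffs) (n : ℕ) : ℝ := -P.β₀ / (P.α₀ - step n * P.β₀)

/-- The functions `v_{n,j}` on `[0,T]` (`j = 1, 2, …`; the value at the index `0` is not used)
determined by the flat output `y`: first `v_{n,1} = y / (α₀ - q₀ β₀)`, then `v_{n,2}`, then
`v_{n,j+1}` for `j ≥ 2` (here `j = i + 2`), by solving the successive equations of the semi-discrete
system. -/
def flat (P : Coeffs) (T : ℝ) (y : ℝ → ℝ) (n : ℕ) : ℕ → ℝ → ℝ
  | 0 => fun _ => 0
  | 1 => fun t => y t / (P.α₀ - P.q₀ n * P.β₀)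
  | 2 => fun t =>
      let h := step n
      let v₁ := flat P T y n 1
      h ^ 2 / ((1 - P.r₀ n) * P.θ h) * derivWithin v₁ (Icc 0 T) t
        - (h ^ 2 * (P.σ h * P.q₀ n + P.lam h) + (4 * P.r₀ n - 2) * P.θ h)
            / ((1 - P.r₀ n) * P.θ h) * v₁ t
  | i + 3 => fun t =>
      let h := step n
      let x := ((i : ℝ) + 2) * h
      let vj := flat P T y n (i + 2)
      let vjm := flat P T y n (i + 1)
      h ^ 2 / P.θ x * derivWithin vj (Icc 0 T) t
        + (h * P.σ x - P.θ x) / P.θ x * vjm t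
        + (2 * P.θ x - h * P.σ x - h ^ 2 * P.lam x) / P.θ x * vj t

/-- The vector `v_n(t) = [v_{n,1}(t), …, v_{n,n}(t)]`. -/
def flatState (P : Coeffs) (T : ℝ) (y : ℝ → ℝ) (n : ℕ) (t : ℝ) : Fin n → ℝ :=
  fun i => P.flat T y n ((i : ℕ) + 1) t

end Coeffs

end ParabolicFlat

end

/-! Both limits are statements about one fixed time `t`, either `0` or `T`. There the `k`-th time
derivative of `v_{n,j}` is compared with `𝒜^k u` at the node `jh`. Both satisfy the same three-term
recursion in space, with level `k + 1` as source: exactly for `v_n`, up to a truncation error for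
`𝒜^k u`. The conditions on `y` make the starting values at the left end agree to the required order.

A discrete Grönwall argument marching from the left bounds the error `E_k` by `K (h M_k + h² ∑∑
|E_{k+1}|)`, where `M_k` bounds the `C¹` norms of `𝒜^k u` and `𝒜^{k+1} u`
(`exists_error_recursion`). Jumps of the coefficients do no harm: the truncation error loses a power
of `h` only at boundedly many nodes (`exists_sum_truncationError_le`).

Each level is thus controlled by the next, over strictly smaller node indices, so the iteration is
finite. It yields the weights `h^(2m) (j+m choose 2m) ≤ 4^m / (2m)!` (`abs_le_sum_of_double_sum`,
`pow_mul_choose_le`).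

The Cauchy data of `𝒜^k u` at `0` are recovered from `y^(k)(t)` and the left boundary condition.
With the `L²` bound on `𝒜^{k+1} u`, the a priori estimate gives growth `Q R^k (k!)^α`
(`exists_gevrey_bound`). As `α < 2`, the factor `(2m)!` wins, and the error is `O(h)` uniformly over
the nodes. -/

namespace ParabolicFlat

/-! ### Discrete Grönwall inequality, iterated summation and the Gevrey series -/

/-- A Grönwall inequality for a second order difference inequality with small step `h`. -/
theorem abs_le_of_second_difference_le {n : ℕ} {h c a : ℝ} (hh : 0 ≤ h) (hh1 : h ≤ 1) (hc : 0 ≤ c)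
    (ha : 0 ≤ a) (hn : n * h ≤ 1) {E F : ℕ → ℝ} (hF : ∀ i, 0 ≤ F i) (h0 : |E 0| ≤ a)
    (h1 : 1 < n → |E 1 - E 0| ≤ h * a)
    (hE : ∀ i, i + 2 < n → |E (i + 2) - 2 * E (i + 1) + E i| ≤
      c * h ^ 2 * (|E (i + 1)| + F (i + 1)) + c * h * |E (i + 1) - E i|) {j : ℕ} (hj : j < n) :
    |E j| ≤ a + Real.exp (2 * c + 1) *
      (2 * a + c * h ^ 2 * ∑ i ∈ Finset.range j, ∑ l ∈ Finset.range (i + 1), F l) := by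
  -- Adding `h |E i|` to the increment gives a quantity with a first order recursion, of growth
  -- factor `1 + (2c + 1) h` per step.
  have key : ∀ i, i + 1 < n → |E (i + 1) - E i| + h * |E i| ≤
      (1 + (2 * c + 1) * h) ^ i * (2 * a * h + c * h ^ 2 * ∑ l ∈ Finset.range (i + 1), F l) := by
    intro i
    induction i with
    | zero =>
      intro hi
      have := h1 (by omega)
      have h3 : h * |E 0| ≤ h * a := by gcongr
      have h4 : 0 ≤ c * h ^ 2 * F 0 := by have := hF 0; positivity
      simp
      linarith
    | succ i ih =>
      intro hi
      have h2 := hE i (by omega)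
      have ih := ih (by omega)
      have e1 : |E (i + 1)| ≤ |E i| + |E (i + 1) - E i| := by
        have := abs_add_le (E i) (E (i + 1) - E i); simpa using this
      have e2 : |E (i + 2) - E (i + 1)| ≤
          |E (i + 2) - 2 * E (i + 1) + E i| + |E (i + 1) - E i| := by
        have := abs_add_le (E (i + 2) - 2 * E (i + 1) + E i) (E (i + 1) - E i)
        refine le_trans (le_of_eq ?_) this
        congr 1; ring
      set d := |E (i + 1) - E i|
      set q := 1 + (2 * c + 1) * h with hq
      have hq1 : 1 ≤ q := by have : 0 ≤ (2 * c + 1) * h := by positivity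
                             linarith
      have hd : 0 ≤ d := abs_nonneg _
      have hF1 := hF (i + 1)
      have step : |E (i + 2) - E (i + 1)| + h * |E (i + 1)| ≤
          q * (d + h * |E i|) + c * h ^ 2 * F (i + 1) := by
        have e3 : (c * h ^ 2 + h) * |E (i + 1)| ≤ (c * h ^ 2 + h) * (|E i| + d) := by gcongr
        have e4 : c * h ^ 2 * d ≤ c * h * d := by
          have : h ^ 2 ≤ h := by nlinarith
          gcongr
        have e5 : 0 ≤ h ^ 2 * |E i| := by positivity
        have e6 : 0 ≤ c * (h ^ 2 * |E i|) := by positivity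
        rw [hq]
        nlinarith
      have hS : 0 ≤ c * h ^ 2 * F (i + 1) := by positivity
      have hqi : 1 ≤ q ^ (i + 1) := one_le_pow₀ hq1
      calc _ ≤ q * (d + h * |E i|) + c * h ^ 2 * F (i + 1) := step
        _ ≤ q * (q ^ i * (2 * a * h + c * h ^ 2 * ∑ l ∈ Finset.range (i + 1), F l))
            + q ^ (i + 1) * (c * h ^ 2 * F (i + 1)) := by
          exact add_le_add (mul_le_mul_of_nonneg_left (ih) (by positivity))
            (le_mul_of_one_le_left hS hqi)
        _ = _ := by rw [Finset.sum_range_succ F (i + 1)]; ring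
  have key2 : ∀ i, i + 1 < n → |E (i + 1) - E i| ≤ Real.exp (2 * c + 1) *
      (2 * a * h + c * h ^ 2 * ∑ l ∈ Finset.range (i + 1), F l) := by
    intro i hi
    have hS : 0 ≤ ∑ l ∈ Finset.range (i + 1), F l := Finset.sum_nonneg fun l _ => hF l
    have e0 : 0 ≤ h * |E i| := by positivity
    refine ((le_add_of_nonneg_right e0).trans (key i hi)).trans
      (mul_le_mul_of_nonneg_right ?_ (by positivity))
    calc (1 + (2 * c + 1) * h) ^ i ≤ Real.exp ((2 * c + 1) * h) ^ i := by
          gcongr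
          have := Real.add_one_le_exp ((2 * c + 1) * h)
          linarith
      _ = Real.exp ((2 * c + 1) * (i * h)) := by rw [← Real.exp_nat_mul]; ring_nf
      _ ≤ _ := by
          apply Real.exp_le_exp.2
          have : (i : ℝ) * h ≤ n * h := by gcongr; omega
          nlinarith
  have key3 : ∀ j, j < n → |E j| ≤ a + ∑ i ∈ Finset.range j, Real.exp (2 * c + 1) *
      (2 * a * h + c * h ^ 2 * ∑ l ∈ Finset.range (i + 1), F l) := by
    intro j
    induction j with
    | zero => intro _; simpa using h0
    | succ j ih =>
      intro hj
      rw [Finset.sum_range_succ]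
      have e1 : |E (j + 1)| ≤ |E j| + |E (j + 1) - E j| := by
        have := abs_add_le (E j) (E (j + 1) - E j); simpa using this
      linarith [key2 j hj, ih (by omega)]
  refine (key3 j hj).trans ?_
  have hjh : (j : ℝ) * h ≤ 1 := le_trans (by gcongr) hn
  have e2 : ∑ _i ∈ Finset.range j, 2 * a * h ≤ 2 * a := by
    simp only [Finset.sum_const, Finset.card_range, nsmul_eq_mul]
    nlinarith
  rw [← Finset.mul_sum, Finset.sum_add_distrib, ← Finset.mul_sum _ _ (c * h ^ 2)]
  gcongr

/-- Two applications of the hockey-stick inequality. With `p = 2m`, a double summation turns the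
weight of index `m` into the one of index `m + 1`, so the bound keeps its shape under iteration. -/
theorem sum_range_sum_range_choose (j m p : ℕ) :
    ∑ i ∈ Finset.range j, ∑ l ∈ Finset.range (i + 1), (l + m).choose p ≤
      (j + m + 1).choose (p + 2) := by
  have h1 : ∀ (p i m : ℕ), ∑ l ∈ Finset.range i, (l + m).choose p ≤ (i + m).choose (p + 1) := by
    intro p i m
    induction i with
    | zero => simp
    | succ i ih =>
      rw [Finset.sum_range_succ, show i + 1 + m = (i + m) + 1 by ring, Nat.choose_succ_succ']
      omega
  calc _ ≤ ∑ i ∈ Finset.range j, (i + (m + 1)).choose (p + 1) := by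
        gcongr with i _
        exact (h1 p (i + 1) m).trans (by rw [show i + 1 + m = i + (m + 1) by ring])
    _ ≤ _ := h1 _ _ _

/-- Iteration of a double summation inequality that bounds a level by the next one. -/
theorem abs_le_sum_of_double_sum {n : ℕ} {h K : ℝ} (hK : 0 ≤ K) {E : ℕ → ℕ → ℝ} {a : ℕ → ℝ}
    (ha : ∀ k, 0 ≤ a k)
    (hE : ∀ k, ∀ j < n, |E k j| ≤ K * (a k + h ^ 2 *
      ∑ i ∈ Finset.range j, ∑ l ∈ Finset.range (i + 1), |E (k + 1) l|)) :
    ∀ j < n, ∀ k, |E k j| ≤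
      ∑ m ∈ Finset.range n, K ^ (m + 1) * a (k + m) * (h ^ (2 * m) * (j + m).choose (2 * m)) := by
  intro j
  -- The inner indices satisfy `l < j`, so induction on the node, with `k` left general, closes the
  -- infinite hierarchy of levels.
  induction j using Nat.strong_induction_on with
  | _ j ih =>
  intro hj k
  set B : ℕ → ℝ := fun m =>
    K ^ (m + 1) * a (k + m) * (h ^ (2 * m) * (j + m).choose (2 * m)) with hB
  -- The binomial vanishes since `j + n < 2n`; hence shifting the summation index stays within
  -- `range n`.
  have hBn : B n = 0 := by
    have : (j + n).choose (2 * n) = 0 := Nat.choose_eq_zero_of_lt (by omega)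
    simp [hB, this]
  have e : ∑ m ∈ Finset.range n, B m = ∑ m ∈ Finset.range n, B (m + 1) + B 0 := by
    have := Finset.sum_range_succ B n
    rw [hBn, add_zero] at this
    rw [← this, Finset.sum_range_succ']
  rw [e]
  refine (hE k j hj).trans ?_
  have b0 : B 0 = K * a k := by simp [hB]
  rw [b0, mul_add, add_comm]
  refine add_le_add ?_ le_rfl
  have h2 : 0 ≤ h ^ 2 := sq_nonneg h
  calc _ ≤ K * (h ^ 2 * ∑ i ∈ Finset.range j, ∑ l ∈ Finset.range (i + 1),
        ∑ m ∈ Finset.range n,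
          K ^ (m + 1) * a (k + 1 + m) * (h ^ (2 * m) * (l + m).choose (2 * m))) := by
        gcongr with i hi l hl
        simp only [Finset.mem_range] at hi hl
        exact ih l (by omega) (by omega) (k + 1)
    _ = ∑ m ∈ Finset.range n, K ^ (m + 2) * a (k + 1 + m) * (h ^ (2 * m + 2) *
        ((∑ i ∈ Finset.range j, ∑ l ∈ Finset.range (i + 1), (l + m).choose (2 * m) : ℕ) : ℝ)) := by
        have : ∀ i, ∑ l ∈ Finset.range (i + 1), ∑ m ∈ Finset.range n,
            K ^ (m + 1) * a (k + 1 + m) * (h ^ (2 * m) * ((l + m).choose (2 * m) : ℝ)) =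
            ∑ m ∈ Finset.range n, ∑ l ∈ Finset.range (i + 1),
            K ^ (m + 1) * a (k + 1 + m) * (h ^ (2 * m) * ((l + m).choose (2 * m) : ℝ)) :=
          fun i => Finset.sum_comm
        simp_rw [this]
        rw [Finset.sum_comm, Finset.mul_sum, Finset.mul_sum]
        refine Finset.sum_congr rfl fun m _ => ?_
        push_cast
        simp_rw [Finset.mul_sum]
        refine Finset.sum_congr rfl fun i _ => Finset.sum_congr rfl fun l _ => ?_
        ring
    _ ≤ _ := by
        refine Finset.sum_le_sum fun m _ => ?_
        have h3 : 0 ≤ h ^ (2 * m + 2) := by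
          rw [show 2 * m + 2 = 2 * (m + 1) by ring, pow_mul]; positivity
        have h4 := ha (k + (m + 1))
        simp only [hB]
        rw [show k + 1 + m = k + (m + 1) by ring, show m + 2 = m + 1 + 1 by ring,
          show 2 * (m + 1) = 2 * m + 2 by ring]
        gcongr
        exact sum_range_sum_range_choose j m (2 * m)

/-- Bound the binomial by `(j + m)^(2m) / (2m)!` and use `(j + m) h ≤ 2`. -/
theorem pow_mul_choose_le {n j m : ℕ} {h : ℝ} (hh : 0 ≤ h) (hn : n * h ≤ 1) (hj : j < n)
    (hm : m < n) : h ^ (2 * m) * (j + m).choose (2 * m) ≤ 4 ^ m / (2 * m)! := by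
  have h1 : ((j + m).choose (2 * m) : ℝ) ≤ ((j + m : ℕ) : ℝ) ^ (2 * m) / (2 * m)! :=
    Nat.choose_le_pow_div _ _
  calc _ ≤ h ^ (2 * m) * (((j + m : ℕ) : ℝ) ^ (2 * m) / (2 * m)!) := by gcongr
    _ = (((j + m : ℕ) : ℝ) * h) ^ (2 * m) / (2 * m)! := by rw [mul_pow]; ring
    _ ≤ 2 ^ (2 * m) / (2 * m)! := by
      gcongr
      have : ((j + m : ℕ) : ℝ) ≤ 2 * n := by exact_mod_cast (by omega : j + m ≤ 2 * n)
      nlinarith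
    _ = _ := by rw [pow_mul]; norm_num

/-- Since `(m!)² ≤ (2m)!`, the terms are at most `R^m (m!)^(α-2)`, whose successive ratios `R
(m+1)^(α-2)` tend to `0` because `α < 2`. -/
theorem summable_gevrey {α R : ℝ} (hα : α < 2) (hR : 0 < R) :
    Summable fun m : ℕ => R ^ m * (m ! : ℝ) ^ α / (2 * m)! := by
  have h1 : Summable fun m : ℕ => R ^ m * (m ! : ℝ) ^ (α - 2) := by
    refine summable_of_ratio_test_tendsto_lt_one (l := 0) one_pos
      (.of_forall fun m => by positivity) ?_
    have : ∀ m : ℕ, ‖R ^ (m + 1) * ((m + 1)! : ℝ) ^ (α - 2)‖ / ‖R ^ m * (m ! : ℝ) ^ (α - 2)‖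
        = R * ((m : ℝ) + 1) ^ (-(2 - α)) := by
      intro m
      rw [Real.norm_of_nonneg (by positivity), Real.norm_of_nonneg (by positivity),
        Nat.factorial_succ, Nat.cast_mul, Real.mul_rpow (by positivity) (by positivity)]
      have : (m ! : ℝ) ^ (α - 2) ≠ 0 := by positivity
      push_cast
      field_simp
      rw [show -(2 - α) = α - 2 by ring, pow_succ]
    simp_rw [this]
    have h2 : Tendsto (fun m : ℕ => ((m : ℝ) + 1) ^ (-(2 - α))) atTop (𝓝 0) :=
      (tendsto_rpow_neg_atTop (by linarith)).comp
        (tendsto_atTop_add_const_right _ _ tendsto_natCast_atTop_atTop)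
    simpa using h2.const_mul R
  refine h1.of_nonneg_of_le (fun m => by positivity) fun m => ?_
  rw [mul_div_assoc]
  gcongr
  have h2 : ((m ! : ℝ)) ^ 2 ≤ (2 * m)! := by
    have := Nat.factorial_mul_factorial_dvd_factorial_add m m
    have := Nat.le_of_dvd (Nat.factorial_pos _) this
    rw [← two_mul] at this
    rw [sq]; exact_mod_cast this
  rw [Real.rpow_sub (by positivity)]
  norm_cast at h2 ⊢
  gcongr

/-! ### Piecewise `C¹` functions on the grid -/

theorem IsPC.exists_lipschitz_pieces {ψ : ℝ → ℝ} (hψ : IsPC 1 ψ) :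
    ∃ (F : Finset (Set ℝ)) (L : ℝ), 0 ≤ L ∧ (∀ J ∈ F, J.OrdConnected) ∧
      (⋃ J ∈ F, J) = unitI ∧ ∀ J ∈ F, ∀ x ∈ J, ∀ y ∈ J, |ψ x - ψ y| ≤ L * |x - y| := by
  obtain ⟨F, hF, -, hU, hg⟩ := hψ
  have h1 : ∀ J ∈ F, ∃ L : ℝ, 0 ≤ L ∧ ∀ x ∈ J, ∀ y ∈ J, |ψ x - ψ y| ≤ L * |x - y| := by
    intro J hJ
    obtain ⟨g, hg1, hg2⟩ := hg J hJ
    obtain ⟨K, hK⟩ := ContDiffOn.exists_lipschitzOnWith hg1 one_ne_zero (convex_Icc 0 1)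
      isCompact_Icc
    refine ⟨K, K.2, fun x hx y hy => ?_⟩
    have hx1 : x ∈ unitI := hU ▸ mem_biUnion hJ hx
    have hy1 : y ∈ unitI := hU ▸ mem_biUnion hJ hy
    rw [hg2 hx, hg2 hy]
    simpa [Real.dist_eq] using hK.dist_le_mul x hx1 y hy1
  choose! L hL0 hL using h1
  refine ⟨F, ∑ J ∈ F, L J, Finset.sum_nonneg hL0, hF, hU, fun J hJ x hx y hy => ?_⟩
  refine (hL J hJ x hx y hy).trans ?_
  gcongr
  exact Finset.single_le_sum hL0 hJ

theorem IsPC.exists_bound {ψ : ℝ → ℝ} (hψ : IsPC 1 ψ) :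
    ∃ B : ℝ, 0 ≤ B ∧ ∀ x ∈ unitI, |ψ x| ≤ B := by
  obtain ⟨F, L, hL0, -, hU, hL⟩ := hψ.exists_lipschitz_pieces
  have h1 : ∀ J ∈ F, ∃ B : ℝ, 0 ≤ B ∧ ∀ x ∈ J, |ψ x| ≤ B := by
    intro J hJ
    rcases J.eq_empty_or_nonempty with rfl | ⟨z, hz⟩
    · exact ⟨0, le_rfl, by simp⟩
    refine ⟨|ψ z| + L, by positivity, fun x hx => ?_⟩
    have hx1 : x ∈ unitI := hU ▸ mem_biUnion hJ hx
    have hz1 : z ∈ unitI := hU ▸ mem_biUnion hJ hz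
    have h2 : |x - z| ≤ 1 := by
      rw [abs_le]; constructor <;> linarith [hx1.1, hx1.2, hz1.1, hz1.2]
    have h3 := hL J hJ x hx z hz
    have h4 := abs_sub_abs_le_abs_sub (ψ x) (ψ z)
    nlinarith
  choose! B hB0 hB using h1
  refine ⟨∑ J ∈ F, B J, Finset.sum_nonneg hB0, fun x hx => ?_⟩
  rw [← hU] at hx
  obtain ⟨J, hJ, hx⟩ := mem_iUnion₂.1 hx
  exact (hB J hJ x hx).trans (Finset.single_le_sum hB0 hJ)

theorem step_pos (n : ℕ) : 0 < step n := by unfold step; positivity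

theorem step_mul (n : ℕ) : step n * (n + 1) = 1 := by
  unfold step; field_simp

theorem node_mem {n i : ℕ} (hi : i ≤ n + 1) : (i : ℝ) * step n ∈ unitI := by
  have h := step_pos n
  refine ⟨by positivity, ?_⟩
  have : (i : ℝ) ≤ n + 1 := by exact_mod_cast hi
  nlinarith [step_mul n]

/-- For all but boundedly many indices, a piecewise `C¹` function varies by `O(h)` over two
neighbouring cells of the grid. -/
theorem IsPC.exists_good_nodes {ψ : ℝ → ℝ} (hψ : IsPC 1 ψ) :
    ∃ (L : ℝ) (N : ℕ), 0 ≤ L ∧ ∀ n : ℕ, ∃ S : Finset ℕ, S.card ≤ N ∧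
      ∀ i < n, i ∉ S → ∀ y ∈ Icc (i * step n) ((i + 2 : ℝ) * step n),
        |ψ y - ψ ((i + 1 : ℝ) * step n)| ≤ L * step n := by
  classical
  obtain ⟨F, L, hL0, hF, hU, hL⟩ := hψ.exists_lipschitz_pieces
  refine ⟨L, 2 * F.card, hL0, fun n => ?_⟩
  have hh := step_pos n
  set h := step n with hdef
  -- `S₁ J` and `S₂ J` record where the grid enters and leaves `J`; by order-connectedness each
  -- happens at most once. Outside them the three nodes of the stencil, hence all points between,
  -- lie in one piece.
  let S₁ : Set ℝ → Finset ℕ := fun J =>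
    {i ∈ Finset.range n | (i + 1 : ℝ) * h ∈ J ∧ (i : ℝ) * h ∉ J}
  let S₂ : Set ℝ → Finset ℕ := fun J =>
    {i ∈ Finset.range n | (i + 1 : ℝ) * h ∈ J ∧ (i + 2 : ℝ) * h ∉ J}
  have c1 : ∀ J ∈ F, (S₁ J).card ≤ 1 := by
    intro J hJ
    have aux : ∀ i j : ℕ, (i + 1 : ℝ) * h ∈ J → (j + 1 : ℝ) * h ∈ J → (j : ℝ) * h ∉ J →
        j ≤ i := by
      intro i j hi hj hj'
      by_contra! hij
      have hij : (i : ℝ) + 1 ≤ j := by exact_mod_cast hij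
      exact hj' ((hF J hJ).out hi hj ⟨by gcongr, by gcongr; linarith⟩)
    refine Finset.card_le_one.2 fun i hi j hj => ?_
    simp only [S₁, Finset.mem_filter] at hi hj
    exact le_antisymm (aux j i hj.2.1 hi.2.1 hi.2.2) (aux i j hi.2.1 hj.2.1 hj.2.2)
  have c2 : ∀ J ∈ F, (S₂ J).card ≤ 1 := by
    intro J hJ
    have aux : ∀ i j : ℕ, (i + 1 : ℝ) * h ∈ J → (j + 1 : ℝ) * h ∈ J → (j + 2 : ℝ) * h ∉ J →
        i ≤ j := by
      intro i j hi hj hj'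
      by_contra! hij
      have hij : (j : ℝ) + 1 ≤ i := by exact_mod_cast hij
      exact hj' ((hF J hJ).out hj hi ⟨mul_le_mul_of_nonneg_right (by linarith) hh.le,
        mul_le_mul_of_nonneg_right (by linarith) hh.le⟩)
    refine Finset.card_le_one.2 fun i hi j hj => ?_
    simp only [S₂, Finset.mem_filter] at hi hj
    exact le_antisymm (aux i j hi.2.1 hj.2.1 hj.2.2) (aux j i hj.2.1 hi.2.1 hi.2.2)
  refine ⟨F.biUnion fun J => S₁ J ∪ S₂ J, ?_, fun i hi hiS y hy => ?_⟩
  · rw [mul_comm]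
    refine Finset.card_biUnion_le_card_mul _ _ _ fun J hJ => ?_
    exact (Finset.card_union_le _ _).trans (by linarith [c1 J hJ, c2 J hJ])
  · have hx : (i + 1 : ℝ) * h ∈ unitI := by
      have := node_mem (n := n) (i := i + 1) (by omega)
      push_cast at this; exact this
    rw [← hU] at hx
    obtain ⟨J, hJ, hx⟩ := mem_iUnion₂.1 hx
    simp only [Finset.mem_biUnion, Finset.mem_union, not_exists, not_and, not_or] at hiS
    obtain ⟨n1, n2⟩ := hiS J hJ
    simp only [S₁, S₂, Finset.mem_filter, Finset.mem_range, not_and, not_not] at n1 n2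
    have hy' : y ∈ J := (hF J hJ).out (n1 hi hx) (n2 hi hx) hy
    refine (hL J hJ y hy' _ hx).trans ?_
    gcongr
    rw [abs_le]
    constructor <;> linarith [hy.1, hy.2]

/-! ### Calculus in `H²(0,1)` and Grönwall's inequality -/

namespace IsH2

variable {w : ℝ → ℝ}

theorem hasDerivWithinAt (hw : IsH2 w) {x : ℝ} (hx : x ∈ unitI) :
    HasDerivWithinAt w (dx w x) unitI x :=
  (hw.contDiffOn.differentiableOn one_ne_zero x hx).hasDerivWithinAt

theorem continuousOn (hw : IsH2 w) : ContinuousOn w unitI := hw.contDiffOn.continuousOn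

theorem continuousOn_dx (hw : IsH2 w) : ContinuousOn (dx w) unitI :=
  hw.contDiffOn.continuousOn_derivWithin (uniqueDiffOn_Icc zero_lt_one) le_rfl

theorem ae_deriv_eq : ∀ᵐ s, s ∈ uIoc (0 : ℝ) 1 → deriv (dx w) s = dx (dx w) s := by
  have h1 : ∀ᵐ s : ℝ, s ≠ 1 := by simp [ae_iff]
  filter_upwards [h1] with s hs1 hs
  rw [uIoc_of_le zero_le_one] at hs
  have : unitI ∈ 𝓝 s := Icc_mem_nhds hs.1 (lt_of_le_of_ne hs.2 hs1)
  exact (derivWithin_of_mem_nhds this).symm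

theorem intervalIntegrable (hw : IsH2 w) {x y : ℝ} (hx : x ∈ unitI) (hy : y ∈ unitI) :
    IntervalIntegrable (dx (dx w)) volume x y := by
  have h1 : IntervalIntegrable (dx (dx w)) volume 0 1 :=
    hw.absCont.intervalIntegrable_deriv.congr_ae
      ((ae_restrict_iff' measurableSet_uIoc).2 ae_deriv_eq)
  refine h1.mono_set ?_
  rw [uIcc_of_le zero_le_one]
  exact uIcc_subset_Icc hx hy

theorem dx_sub (hw : IsH2 w) {x y : ℝ} (hx : x ∈ unitI) (hy : y ∈ unitI) :
    dx w y - dx w x = ∫ s in x..y, dx (dx w) s := by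
  have hsub : uIcc x y ⊆ uIcc 0 1 := by
    rw [uIcc_of_le zero_le_one]; exact uIcc_subset_Icc hx hy
  rw [← (hw.absCont.mono hsub).integral_deriv_eq_sub]
  refine intervalIntegral.integral_congr_ae ?_
  filter_upwards [ae_deriv_eq (w := w)] with s hs hs'
  refine hs ?_
  rw [uIoc_of_le zero_le_one]
  rw [uIoc, mem_Ioc] at hs'
  exact ⟨(le_min hx.1 hy.1).trans_lt hs'.1, hs'.2.trans (max_le hx.2 hy.2)⟩

/-- Taylor's formula with a remainder estimated by the distance of `w_xx` from a constant. -/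
theorem taylor (hw : IsH2 w) {a b W η : ℝ} (ha : 0 ≤ a) (hb : b ≤ 1)
    (hW : ∀ᵐ s ∂vol01, s ∈ Icc a b → |dx (dx w) s - W| ≤ η) {x y : ℝ} (hx : x ∈ Icc a b)
    (hy : y ∈ Icc a b) :
    |dx w y - dx w x - W * (y - x)| ≤ η * |y - x| ∧
      |w y - w x - dx w x * (y - x) - W * (y - x) ^ 2 / 2| ≤ η * (y - x) ^ 2 := by
  have hI : Icc a b ⊆ unitI := Icc_subset_Icc ha hb
  have hW' : ∀ᵐ s : ℝ, s ∈ Icc a b → s ≠ 0 → s ≠ 1 → |dx (dx w) s - W| ≤ η := by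
    have h2 := (ae_restrict_iff' measurableSet_Ioo).1 hW
    filter_upwards [h2] with s hs h1 h3 h4
    exact hs ⟨lt_of_le_of_ne (hI h1).1 (Ne.symm h3), lt_of_le_of_ne (hI h1).2 h4⟩ h1
  have first : ∀ x ∈ Icc a b, ∀ y ∈ Icc a b,
      |dx w y - dx w x - W * (y - x)| ≤ η * |y - x| := by
    intro x hx y hy
    have e : dx w y - dx w x - W * (y - x) = ∫ s in x..y, (dx (dx w) s - W) := by
      rw [intervalIntegral.integral_sub (hw.intervalIntegrable (hI hx) (hI hy))
        intervalIntegrable_const, hw.dx_sub (hI hx) (hI hy), intervalIntegral.integral_const,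
        smul_eq_mul, mul_comm W]
    rw [e, ← Real.norm_eq_abs]
    refine intervalIntegral.norm_integral_le_of_norm_le_const_ae ?_
    have h0 : ∀ᵐ s : ℝ, s ≠ 0 := by simp [ae_iff]
    have h1 : ∀ᵐ s : ℝ, s ≠ 1 := by simp [ae_iff]
    filter_upwards [hW', h0, h1] with s hs hs0 hs1 hm
    exact hs (uIcc_subset_Icc hx hy (uIoc_subset_uIcc hm)) hs0 hs1
  refine ⟨first x hx y hy, ?_⟩
  have hη : 0 ≤ η * |y - x| := (abs_nonneg _).trans (first x hx y hy)
  have hsub : uIcc x y ⊆ Icc a b := uIcc_subset_Icc hx hy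
  -- The mean value inequality for the remainder, whose derivative is controlled by `first`; the
  -- lost factor `1/2` is immaterial.
  have key := (convex_uIcc x y).norm_image_sub_le_of_norm_hasDerivWithin_le
    (f := fun s => w s - dx w x * (s - x) - W * (s - x) ^ 2 / 2)
    (f' := fun s => dx w s - dx w x - W * (s - x)) (C := η * |y - x|)
    (fun s hs => by
      have h1 := (hw.hasDerivWithinAt (hI (hsub hs))).mono (hsub.trans hI)
      have h2 : HasDerivWithinAt (fun s => dx w x * (s - x)) (dx w x * 1) (uIcc x y) s :=
        ((hasDerivWithinAt_id s _).sub_const x).const_mul _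
      have h3 : HasDerivWithinAt (fun s => W * (s - x) ^ 2 / 2)
          (W * ((2 : ℕ) * (s - x) ^ (2 - 1) * 1) / 2) (uIcc x y) s :=
        ((((hasDerivWithinAt_id s _).sub_const x).pow 2).const_mul W).div_const 2
      refine ((h1.sub h2).sub h3).congr_deriv ?_
      norm_num
      ring)
    (fun s hs => by
      rw [Real.norm_eq_abs]
      refine (first x hx s (hsub hs)).trans ?_
      -- For `y = x` nothing forces `η` to be nonnegative.
      rcases eq_or_ne y x with rfl | hne
      · simp at hs; simp [hs]
      have hη' : 0 ≤ η := nonneg_of_mul_nonneg_left hη (abs_pos.2 (sub_ne_zero.2 hne))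
      exact mul_le_mul_of_nonneg_left (abs_sub_left_of_mem_uIcc hs) hη')
    left_mem_uIcc right_mem_uIcc
  simp only [Real.norm_eq_abs, sub_self] at key
  have e1 : η * |y - x| * |y - x| = η * (y - x) ^ 2 := by rw [mul_assoc, abs_mul_abs_self]; ring
  rw [e1] at key
  refine le_trans (le_of_eq ?_) key
  congr 1
  ring

end IsH2

theorem IsH2.lipschitz {w : ℝ → ℝ} (hw : IsH2 w) {M : ℝ} (hM : ∀ x ∈ unitI, |dx w x| ≤ M) {x y : ℝ}
    (hx : x ∈ unitI) (hy : y ∈ unitI) : |w y - w x| ≤ M * |y - x| :=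
  (convex_Icc (0 : ℝ) 1).norm_image_sub_le_of_norm_hasDerivWithin_le
    (fun _ hs => hw.hasDerivWithinAt hs) hM hx hy

/-- Grönwall's inequality in integral form on `[0,1]`. -/
theorem le_mul_exp_of_le_add_integral {p : ℝ → ℝ} {a K : ℝ} (hp : ContinuousOn p unitI)
    (hp0 : ∀ x ∈ unitI, 0 ≤ p x) (hK : 0 ≤ K) (ha : 0 ≤ a)
    (h : ∀ x ∈ unitI, p x ≤ a + K * ∫ s in (0 : ℝ)..x, p s) :
    ∀ x ∈ unitI, p x ≤ a * Real.exp K := by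
  -- Continuous extension by constants, so that the integral is differentiable at every real point,
  -- end points included.
  set ψ : ℝ → ℝ := IccExtend (zero_le_one' ℝ) ((Icc 0 1).domRestrict p) with hψ
  have hψc : Continuous ψ := (continuousOn_iff_continuous_domRestrict.1 hp).Icc_extend'
  have hψe : ∀ x ∈ unitI, ψ x = p x := fun x hx => by
    rw [hψ, IccExtend_of_mem _ _ hx]; rfl
  have hint : ∀ x ∈ unitI, ∫ s in (0 : ℝ)..x, p s = ∫ s in (0 : ℝ)..x, ψ s := fun x hx =>
    intervalIntegral.integral_congr fun s hs => by
      rw [uIcc_of_le hx.1] at hs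
      exact (hψe s ⟨hs.1, hs.2.trans hx.2⟩).symm
  have hI0 : ∀ x ∈ unitI, 0 ≤ ∫ s in (0 : ℝ)..x, ψ s := fun x hx =>
    intervalIntegral.integral_nonneg hx.1 fun s hs => by
      have hs' : s ∈ unitI := ⟨hs.1, hs.2.trans hx.2⟩
      rw [hψe s hs']; exact hp0 s hs'
  have hd : ∀ x, HasDerivAt (fun x => a + K * ∫ s in (0 : ℝ)..x, ψ s) (K * ψ x) x := fun x =>
    ((hψc.integral_hasStrictDerivAt 0 x).hasDerivAt.const_mul K).const_add a
  have key := norm_le_gronwallBound_of_norm_deriv_right_le (a := 0) (b := 1) (δ := a) (K := K)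
    (ε := 0) (f := fun x => a + K * ∫ s in (0 : ℝ)..x, ψ s) (f' := fun x => K * ψ x)
    (fun x _ => (hd x).continuousAt.continuousWithinAt) (fun x _ => (hd x).hasDerivWithinAt)
    (by simp [abs_of_nonneg ha]) (fun x hx => by
      have hx' : x ∈ unitI := ⟨hx.1, hx.2.le⟩
      have h1 := h x hx'
      have h2 := hI0 x hx'
      rw [hint x hx'] at h1
      have h3 := hp0 x hx'
      rw [hψe x hx', Real.norm_of_nonneg (by positivity), Real.norm_of_nonneg (by positivity),
        add_zero]
      gcongr)
  intro x hx
  have h1 := key x hx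
  have h2 := hI0 x hx
  have h3 := h x hx
  rw [hint x hx] at h3
  rw [Real.norm_of_nonneg (by positivity), gronwallBound_ε0, sub_zero] at h1
  refine (h3.trans h1).trans ?_
  gcongr
  nlinarith [hx.2]

theorem integral_abs_le_of_eLpNorm_le {g : ℝ → ℝ} (hg : ContinuousOn g unitI) {R : ℝ} (hR : 0 ≤ R)
    (h : eLpNorm g 2 vol01 ≤ ENNReal.ofReal R) : ∫ s in (0 : ℝ)..1, |g s| ≤ R := by
  have hm : AEStronglyMeasurable g vol01 :=
    (hg.mono Ioo_subset_Icc_self).aestronglyMeasurable measurableSet_Ioo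
  have hprob : IsProbabilityMeasure vol01 := ⟨by simp [vol01]⟩
  have h1 : eLpNorm g 1 vol01 ≤ ENNReal.ofReal R :=
    (eLpNorm_le_eLpNorm_of_exponent_le (by norm_num) hm).trans h
  rw [intervalIntegral.integral_of_le zero_le_one, integral_Ioc_eq_integral_Ioo]
  change ∫ s, ‖g s‖ ∂vol01 ≤ R
  rw [integral_norm_eq_lintegral_enorm hm, ← eLpNorm_one_eq_lintegral_enorm]
  exact ENNReal.toReal_le_of_le_ofReal hR h1

/-! ### Coefficient bounds and the a priori estimate -/

namespace Coeffs

/-- Bounds for the coefficients of the operator. -/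
structure Bounds (P : Coeffs) (C : ℝ) : Prop where
  one_le : 1 ≤ C
  θ_pos : ∀ x ∈ unitI, 0 < P.θ x
  θ_inv : ∀ x ∈ unitI, (P.θ x)⁻¹ ≤ C
  θ_le : ∀ x ∈ unitI, |P.θ x| ≤ C
  σ_le : ∀ x ∈ unitI, |P.σ x| ≤ C
  lam_le : ∀ x ∈ unitI, |P.lam x| ≤ C

theorem Admissible.exists_bounds {P : Coeffs} (hP : P.Admissible) : ∃ C, P.Bounds C := by
  obtain ⟨c, hc, hθ⟩ := hP.θ_pos
  obtain ⟨B₁, h1, hB₁⟩ := hP.θ_pc.exists_bound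
  obtain ⟨B₂, h2, hB₂⟩ := hP.σ_pc.exists_bound
  obtain ⟨B₃, h3, hB₃⟩ := hP.lam_pc.exists_bound
  have hc' : 0 < c⁻¹ := inv_pos.2 hc
  refine ⟨1 + c⁻¹ + B₁ + B₂ + B₃, by linarith, fun x hx => hc.trans_le (hθ x hx), fun x hx => ?_,
    fun x hx => ?_, fun x hx => ?_, fun x hx => ?_⟩
  · have := inv_anti₀ hc (hθ x hx); linarith
  · linarith [hB₁ x hx]
  · linarith [hB₂ x hx]
  · linarith [hB₃ x hx]

theorem Bounds.abs_le_of_mul_eq {P : Coeffs} {C : ℝ} (hC : P.Bounds C) {x a b : ℝ} (hx : x ∈ unitI)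
    (h : P.θ x * a = b) : |a| ≤ C * |b| := by
  have h0 := hC.θ_pos x hx
  have : a = (P.θ x)⁻¹ * b := by rw [← h]; field_simp
  rw [this, abs_mul, abs_of_pos (inv_pos.2 h0)]
  gcongr
  exact hC.θ_inv x hx

/-- The `C¹` norm of `w` is controlled by the Cauchy data at `0` and the `L²` norm of `𝒜 w`. -/
theorem Bounds.apriori {P : Coeffs} {C : ℝ} (hC : P.Bounds C) {w g : ℝ → ℝ} (hw : IsH2 w)
    (hg : ContinuousOn g unitI) (hwg : P.opA w =ᵐ[vol01] g) {R : ℝ} (hR : 0 ≤ R)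
    (hgR : eLpNorm g 2 vol01 ≤ ENNReal.ofReal R) {x : ℝ} (hx : x ∈ unitI) :
    |w x| + |dx w x| ≤ (|w 0| + |dx w 0| + C * R) * Real.exp (C * C + 1) := by
  have hC1 := hC.one_le
  have m0 : (0 : ℝ) ∈ unitI := ⟨le_rfl, zero_le_one⟩
  have hwc := hw.continuousOn
  have hdc := hw.continuousOn_dx
  have ii : ∀ {f : ℝ → ℝ}, ContinuousOn f unitI → ∀ x ∈ unitI,
      IntervalIntegrable f volume 0 x := fun hf x hx =>
    (hf.mono (by rw [uIcc_of_le hx.1]; exact Icc_subset_Icc le_rfl hx.2)).intervalIntegrable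
  -- Grönwall for the first order system in `(w, w_x)`: the rate `C * C` comes from solving the
  -- equation for `w_xx`, the rate `1` from integrating `w_x`.
  refine le_mul_exp_of_le_add_integral (p := fun s => |w s| + |dx w s|) (hwc.abs.add hdc.abs)
    (fun _ _ => by positivity) (by positivity) (by positivity) (fun x hx => ?_) x hx
  have hae : ∀ᵐ s : ℝ, s ∈ Ioo (0 : ℝ) 1 →
      |dx (dx w) s| ≤ C * |g s| + C * C * (|w s| + |dx w s|) := by
    filter_upwards [(ae_restrict_iff' measurableSet_Ioo).1 hwg] with s hs hs'
    have hsI : s ∈ unitI := Ioo_subset_Icc_self hs'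
    have e := hs hs'
    simp only [opA] at e
    refine (hC.abs_le_of_mul_eq hsI (b := g s - P.σ s * dx w s - P.lam s * w s)
      (by linarith)).trans ?_
    have h1 : |P.σ s * dx w s| ≤ C * |dx w s| := by
      rw [abs_mul]; gcongr; exact hC.σ_le s hsI
    have h2 : |P.lam s * w s| ≤ C * |w s| := by
      rw [abs_mul]; gcongr; exact hC.lam_le s hsI
    have h3 := abs_sub (g s - P.σ s * dx w s) (P.lam s * w s)
    have h4 := abs_sub (g s) (P.σ s * dx w s)
    rw [mul_assoc, ← mul_add]
    gcongr
    linarith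
  have hd : |dx w x - dx w 0| ≤
      C * (∫ s in (0 : ℝ)..x, |g s|) + C * C * ∫ s in (0 : ℝ)..x, (|w s| + |dx w s|) := by
    rw [hw.dx_sub m0 hx]
    have i1 := (ii hg.abs x hx).const_mul C
    have i2 : IntervalIntegrable (fun s => C * C * (|w s| + |dx w s|)) volume 0 x :=
      (ii (hwc.abs.add hdc.abs) x hx).const_mul (C * C)
    rw [← intervalIntegral.integral_const_mul, ← intervalIntegral.integral_const_mul,
      ← intervalIntegral.integral_add i1 i2, ← Real.norm_eq_abs]
    refine intervalIntegral.norm_integral_le_of_norm_le hx.1 ?_ (i1.add i2)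
    have h1 : ∀ᵐ s : ℝ, s ≠ 1 := by simp [ae_iff]
    filter_upwards [hae, h1] with s hs hs1 hm
    exact hs ⟨hm.1, lt_of_le_of_ne (hm.2.trans hx.2) hs1⟩
  have hw0 : |w x - w 0| ≤ ∫ s in (0 : ℝ)..x, (|w s| + |dx w s|) := by
    have e : ∫ s in (0 : ℝ)..x, dx w s = w x - w 0 :=
      intervalIntegral.integral_eq_sub_of_hasDerivAt_of_le hx.1
        (hwc.mono (Icc_subset_Icc le_rfl hx.2))
        (fun s hs => (hw.hasDerivWithinAt ⟨hs.1.le, hs.2.le.trans hx.2⟩).hasDerivAt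
          (Icc_mem_nhds hs.1 (hs.2.trans_le hx.2))) (ii hdc x hx)
    rw [← e, ← Real.norm_eq_abs]
    refine intervalIntegral.norm_integral_le_of_norm_le hx.1 (.of_forall fun s _ => ?_)
      (ii (hwc.abs.add hdc.abs) x hx)
    rw [Real.norm_eq_abs]
    linarith [abs_nonneg (w s)]
  have hgx : ∫ s in (0 : ℝ)..x, |g s| ≤ R := by
    refine le_trans ?_ (integral_abs_le_of_eLpNorm_le hg hR hgR)
    exact intervalIntegral.integral_mono_interval le_rfl hx.1 hx.2
      (.of_forall fun _ => abs_nonneg _) (ii hg.abs 1 ⟨zero_le_one, le_rfl⟩)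
  have t1 := abs_sub_abs_le_abs_sub (w x) (w 0)
  have t2 := abs_sub_abs_le_abs_sub (dx w x) (dx w 0)
  have t3 : C * (∫ s in (0 : ℝ)..x, |g s|) ≤ C * R := by gcongr
  nlinarith

end Coeffs

/-! ### Truncation error of the difference scheme -/

namespace Coeffs

variable {P : Coeffs} {C : ℝ} {w g : ℝ → ℝ} {M : ℝ}

theorem Bounds.ae_abs_le (hC : P.Bounds C) (hwg : P.opA w =ᵐ[vol01] g)
    (hM : ∀ x ∈ unitI, |w x| ≤ M) (hM' : ∀ x ∈ unitI, |dx w x| ≤ M)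
    (hg : ∀ x ∈ unitI, |g x| ≤ M) : ∀ᵐ s ∂vol01, |dx (dx w) s| ≤ 3 * C ^ 2 * M := by
  have hC1 := hC.one_le
  refine (ae_restrict_iff' measurableSet_Ioo).2 ?_
  filter_upwards [(ae_restrict_iff' measurableSet_Ioo).1 hwg] with s hs hs'
  have hsI : s ∈ unitI := Ioo_subset_Icc_self hs'
  have e := hs hs'
  simp only [opA] at e
  have hM0 : 0 ≤ M := (abs_nonneg _).trans (hM s hsI)
  refine (hC.abs_le_of_mul_eq hsI (b := g s - P.σ s * dx w s - P.lam s * w s)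
    (by linarith)).trans ?_
  have h1 : |P.σ s * dx w s| ≤ C * M := by
    rw [abs_mul]; gcongr; exacts [hC.σ_le s hsI, hM' s hsI]
  have h2 : |P.lam s * w s| ≤ C * M := by
    rw [abs_mul]; gcongr; exacts [hC.lam_le s hsI, hM s hsI]
  have h3 := abs_sub (g s - P.σ s * dx w s) (P.lam s * w s)
  have h4 := abs_sub (g s) (P.σ s * dx w s)
  have h5 := hg s hsI
  have h6 : M ≤ C * M := le_mul_of_one_le_left hM0 hC1
  calc _ ≤ C * (3 * (C * M)) := by gcongr; linarith
    _ = _ := by ring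

theorem Bounds.taylor (hC : P.Bounds C) (hw : IsH2 w) (hwg : P.opA w =ᵐ[vol01] g)
    (hM : ∀ x ∈ unitI, |w x| ≤ M) (hM' : ∀ x ∈ unitI, |dx w x| ≤ M)
    (hg : ∀ x ∈ unitI, |g x| ≤ M) {x y : ℝ} (hx : x ∈ unitI) (hy : y ∈ unitI) :
    |dx w y - dx w x| ≤ 3 * C ^ 2 * M * |y - x| ∧
      |w y - w x - dx w x * (y - x)| ≤ 3 * C ^ 2 * M * (y - x) ^ 2 := by
  have := hw.taylor (a := 0) (b := 1) (W := 0) (η := 3 * C ^ 2 * M) le_rfl le_rfl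
    (by filter_upwards [hC.ae_abs_le hwg hM hM' hg] with s hs _; simpa using hs) hx hy
  simpa using this

/-- The truncation error of the difference scheme in terms of the oscillation of the coefficients
over the stencil. -/
theorem Bounds.truncation (hC : P.Bounds C) (hw : IsH2 w) (hgH : IsH2 g)
    (hwg : P.opA w =ᵐ[vol01] g)
    (hM : ∀ x ∈ unitI, |w x| ≤ M) (hM' : ∀ x ∈ unitI, |dx w x| ≤ M)
    (hg : ∀ x ∈ unitI, |g x| ≤ M) (hg' : ∀ x ∈ unitI, |dx g x| ≤ M) {x h q : ℝ} (hh : 0 ≤ h)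
    (hx0 : 0 ≤ x - h) (hx1 : x + h ≤ 1)
    (hθ : ∀ y ∈ Icc (x - h) (x + h), |P.θ y - P.θ x| ≤ q)
    (hσ : ∀ y ∈ Icc (x - h) (x + h), |P.σ y - P.σ x| ≤ q)
    (hlam : ∀ y ∈ Icc (x - h) (x + h), |P.lam y - P.lam x| ≤ q) :
    |P.θ x * (w (x + h) - 2 * w x + w (x - h)) + h * P.σ x * (w x - w (x - h))
      + h ^ 2 * (P.lam x * w x - g x)| ≤ 13 * C ^ 5 * M * (q + h) * h ^ 2 := by
  have hC1 := hC.one_le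
  have hx : x ∈ unitI := ⟨by linarith, by linarith⟩
  have mx : x ∈ Icc (x - h) (x + h) := ⟨by linarith, by linarith⟩
  have hq : 0 ≤ q := (abs_nonneg _).trans (hθ x mx)
  have hM0 : 0 ≤ M := (abs_nonneg _).trans (hM x hx)
  have hθx := hC.θ_pos x hx
  -- The value that the equation with coefficients taken at `x` assigns to `w_xx`, which itself
  -- exists only almost everywhere.
  set W := (P.θ x)⁻¹ * (g x - P.σ x * dx w x - P.lam x * w x) with hWdef
  have hWe : P.θ x * W = g x - P.σ x * dx w x - P.lam x * w x := by
    rw [hWdef]; field_simp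
  have c2 : 1 ≤ C ^ 2 := one_le_pow₀ hC1
  have c3 : C ≤ C ^ 3 := le_self_pow₀ hC1 (by norm_num)
  have c23 : C ^ 2 ≤ C ^ 3 := pow_le_pow_right₀ hC1 (by norm_num)
  have hWM : |W| ≤ 3 * C ^ 2 * M := by
    refine (hC.abs_le_of_mul_eq hx hWe).trans ?_
    have h1 : |P.σ x * dx w x| ≤ C * M := by
      rw [abs_mul]; gcongr; exacts [hC.σ_le x hx, hM' x hx]
    have h2 : |P.lam x * w x| ≤ C * M := by
      rw [abs_mul]; gcongr; exacts [hC.lam_le x hx, hM x hx]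
    have h3 := abs_sub (g x - P.σ x * dx w x) (P.lam x * w x)
    have h4 := abs_sub (g x) (P.σ x * dx w x)
    have h5 := hg x hx
    have h6 : M ≤ C * M := le_mul_of_one_le_left hM0 hC1
    calc _ ≤ C * (3 * (C * M)) := by gcongr; linarith
      _ = _ := by ring
  have hae : ∀ᵐ s ∂vol01, s ∈ Icc (x - h) (x + h) →
      |dx (dx w) s - W| ≤ 5 * C ^ 4 * M * (q + h) := by
    refine (ae_restrict_iff' measurableSet_Ioo).2 ?_
    filter_upwards [(ae_restrict_iff' measurableSet_Ioo).1 hwg] with s hs hs' hsW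
    have hsI : s ∈ unitI := Ioo_subset_Icc_self hs'
    have e := hs hs'
    simp only [opA] at e
    have hsx : |s - x| ≤ h := by rw [abs_le]; constructor <;> linarith [hsW.1, hsW.2]
    -- The equations at `s` and at `x` are subtracted: every term is a coefficient oscillation, at
    -- most `q`, or an increment of `g`, `w`, `w_x`, which is `O(h)`.
    have e2 : P.θ s * (dx (dx w) s - W) = (g s - g x) - (P.σ s - P.σ x) * dx w s
        - P.σ x * (dx w s - dx w x) - (P.lam s - P.lam x) * w s - P.lam x * (w s - w x)
        - (P.θ s - P.θ x) * W := by linear_combination e - hWe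
    refine (hC.abs_le_of_mul_eq hsI e2).trans ?_
    have b1 : |g s - g x| ≤ M * h := (hgH.lipschitz hg' hx hsI).trans (by gcongr)
    have b2 : |(P.σ s - P.σ x) * dx w s| ≤ q * M := by
      rw [abs_mul]; gcongr; exacts [hσ s hsW, hM' s hsI]
    have b3 : |P.σ x * (dx w s - dx w x)| ≤ C * (3 * C ^ 2 * M * h) := by
      rw [abs_mul]; gcongr
      · exact hC.σ_le x hx
      · exact ((hC.taylor hw hwg hM hM' hg hx hsI).1).trans (by gcongr)
    have b4 : |(P.lam s - P.lam x) * w s| ≤ q * M := by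
      rw [abs_mul]; gcongr; exacts [hlam s hsW, hM s hsI]
    have b5 : |P.lam x * (w s - w x)| ≤ C * (M * h) := by
      rw [abs_mul]; gcongr
      · exact hC.lam_le x hx
      · exact (hw.lipschitz hM' hx hsI).trans (by gcongr)
    have b6 : |(P.θ s - P.θ x) * W| ≤ q * (3 * C ^ 2 * M) := by
      rw [abs_mul]; gcongr; exact hθ s hsW
    have b7 : M * h ≤ C ^ 3 * (M * h) := le_mul_of_one_le_left (by positivity) (by linarith)
    have b8 : q * M ≤ C ^ 3 * (q * M) := le_mul_of_one_le_left (by positivity) (by linarith)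
    have b9 : C * (M * h) ≤ C ^ 3 * (M * h) := by gcongr
    have b10 : C ^ 2 * (q * M) ≤ C ^ 3 * (q * M) := by gcongr
    have t : ∀ a b c d e f : ℝ, |a - b - c - d - e - f| ≤ |a| + |b| + |c| + |d| + |e| + |f| := by
      intro a b c d e f
      linarith [abs_sub (a - b - c - d - e) f, abs_sub (a - b - c - d) e, abs_sub (a - b - c) d,
        abs_sub (a - b) c, abs_sub a b]
    calc _ ≤ C * (5 * (C ^ 3 * (M * h)) + 5 * (C ^ 3 * (q * M))) := by
          gcongr
          refine (t _ _ _ _ _ _).trans ?_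
          linarith
      _ = _ := by ring
  have t1 := (hw.taylor hx0 hx1 hae mx (y := x + h) ⟨by linarith, le_rfl⟩).2
  have t2 := (hw.taylor hx0 hx1 hae mx (y := x - h) ⟨le_rfl, by linarith⟩).2
  have t3 := (hC.taylor hw hwg hM hM' hg hx (y := x - h) ⟨hx0, by linarith⟩).2
  rw [show x + h - x = h by ring] at t1
  rw [show x - h - x = -h by ring] at t2 t3
  -- The terms of Taylor's formula cancel by the choice of `W`; only remainders are left, those of
  -- the second difference giving `10` and that of the backward difference `3` of the constant `13`.
  have e : P.θ x * (w (x + h) - 2 * w x + w (x - h)) + h * P.σ x * (w x - w (x - h))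
      + h ^ 2 * (P.lam x * w x - g x) =
      P.θ x * ((w (x + h) - w x - dx w x * h - W * h ^ 2 / 2)
        + (w (x - h) - w x - dx w x * (-h) - W * (-h) ^ 2 / 2))
      - h * P.σ x * (w (x - h) - w x - dx w x * (-h)) := by linear_combination h ^ 2 * hWe
  rw [e]
  refine (abs_sub _ _).trans ?_
  rw [abs_mul, abs_mul, abs_mul, abs_of_nonneg hh]
  have s1 := abs_add_le (w (x + h) - w x - dx w x * h - W * h ^ 2 / 2)
    (w (x - h) - w x - dx w x * (-h) - W * (-h) ^ 2 / 2)
  have c5 : C ^ 3 ≤ C ^ 5 := pow_le_pow_right₀ hC1 (by norm_num)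
  calc _ ≤ C * (2 * (5 * C ^ 4 * M * (q + h) * h ^ 2)) + h * C * (3 * C ^ 2 * M * (-h) ^ 2) := by
        gcongr
        · exact hC.θ_le x hx
        · rw [neg_sq] at t2 s1 ⊢
          linarith
        · exact hC.σ_le x hx
    _ = 10 * C ^ 5 * M * (q + h) * h ^ 2 + 3 * (C ^ 3 * (M * h * h ^ 2)) := by ring
    _ ≤ 10 * C ^ 5 * M * (q + h) * h ^ 2 + 3 * (C ^ 5 * (M * (q + h) * h ^ 2)) := by
        gcongr
        linarith
    _ = _ := by ring

/-- The truncation error of the difference scheme at the node `(i + 1) h`, multiplied by `h²`. -/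
noncomputable def truncationError (P : Coeffs) (n : ℕ) (w g : ℝ → ℝ) (i : ℕ) : ℝ :=
  P.θ ((i + 1) * step n) * (w ((i + 2) * step n) - 2 * w ((i + 1) * step n) + w (i * step n))
    + step n * P.σ ((i + 1) * step n) * (w ((i + 1) * step n) - w (i * step n))
    + step n ^ 2 * (P.lam ((i + 1) * step n) * w ((i + 1) * step n) - g ((i + 1) * step n))

/-- The truncation errors sum up to `O(h²)`: they are `O(h³)` at all but boundedly many nodes and
`O(h²)` at the remaining ones. -/
theorem Admissible.exists_sum_truncationError_le (hP : P.Admissible) :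
    ∃ K : ℝ, 0 ≤ K ∧ ∀ (n : ℕ) (w g : ℝ → ℝ) (M : ℝ), IsH2 w → IsH2 g → P.opA w =ᵐ[vol01] g →
      (∀ x ∈ unitI, |w x| ≤ M) → (∀ x ∈ unitI, |dx w x| ≤ M) →
      (∀ x ∈ unitI, |g x| ≤ M) → (∀ x ∈ unitI, |dx g x| ≤ M) →
      ∑ i ∈ Finset.range n, |P.truncationError n w g i| ≤ K * M * step n ^ 2 := by
  obtain ⟨C, hC⟩ := hP.exists_bounds
  have hC1 := hC.one_le
  obtain ⟨L₁, N₁, hL₁, H₁⟩ := hP.θ_pc.exists_good_nodes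
  obtain ⟨L₂, N₂, hL₂, H₂⟩ := hP.σ_pc.exists_good_nodes
  obtain ⟨L₃, N₃, hL₃, H₃⟩ := hP.lam_pc.exists_good_nodes
  set L := L₁ + L₂ + L₃ with hL
  have hL0 : 0 ≤ L := by positivity
  -- The first summand is for the good nodes, of oscillation `L h`, at most `1/h` in number. The
  -- second is for the exceptional ones, where the oscillation is only bounded by `2 * C`.
  refine ⟨13 * C ^ 5 * (L + 1) + (N₁ + N₂ + N₃) * (13 * C ^ 5 * (2 * C + 1)), by positivity,
    fun n w g M hw hg hwg hM hM' hgM hgM' => ?_⟩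
  have hM0 : 0 ≤ M := (abs_nonneg _).trans (hM 0 ⟨le_rfl, zero_le_one⟩)
  obtain ⟨S₁, hS₁, G₁⟩ := H₁ n
  obtain ⟨S₂, hS₂, G₂⟩ := H₂ n
  obtain ⟨S₃, hS₃, G₃⟩ := H₃ n
  have hh := step_pos n
  have hh1 : step n ≤ 1 := by
    have := (node_mem (n := n) (i := 1) (by omega)).2
    simpa using this
  set h := step n with hdef
  have hmem : ∀ i < n, 0 ≤ (i + 1 : ℝ) * h - h ∧ (i + 1 : ℝ) * h + h ≤ 1 := by
    intro i hi
    have h2 := (node_mem (n := n) (i := i + 2) (by omega)).2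
    push_cast at h2
    rw [← hdef] at h2
    have : 0 ≤ (i : ℝ) * h := by positivity
    constructor <;> linarith
  have hT : ∀ i < n, ∀ q : ℝ,
      (∀ y ∈ Icc ((i : ℝ) * h) ((i + 2 : ℝ) * h), |P.θ y - P.θ ((i + 1) * h)| ≤ q) →
      (∀ y ∈ Icc ((i : ℝ) * h) ((i + 2 : ℝ) * h), |P.σ y - P.σ ((i + 1) * h)| ≤ q) →
      (∀ y ∈ Icc ((i : ℝ) * h) ((i + 2 : ℝ) * h), |P.lam y - P.lam ((i + 1) * h)| ≤ q) →
      |P.truncationError n w g i| ≤ 13 * C ^ 5 * M * (q + h) * h ^ 2 := by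
    intro i hi q k1 k2 k3
    have e1 : (i : ℝ) * h = (i + 1) * h - h := by ring
    have e2 : (i + 2 : ℝ) * h = (i + 1) * h + h := by ring
    unfold truncationError
    rw [← hdef]
    rw [e1, e2] at k1 k2 k3 ⊢
    exact hC.truncation hw hg hwg hM hM' hgM hgM' hh.le (hmem i hi).1 (hmem i hi).2 k1 k2 k3
  have hgood : ∀ i < n, i ∉ S₁ ∪ S₂ ∪ S₃ →
      |P.truncationError n w g i| ≤ 13 * C ^ 5 * (L + 1) * M * h ^ 2 * h := by
    intro i hi hiS
    simp only [Finset.mem_union, not_or] at hiS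
    have := hT i hi (L * h)
      (fun y hy => (G₁ i hi hiS.1.1 y hy).trans (by gcongr; linarith))
      (fun y hy => (G₂ i hi hiS.1.2 y hy).trans (by gcongr; linarith))
      (fun y hy => (G₃ i hi hiS.2 y hy).trans (by gcongr; linarith))
    refine this.trans (le_of_eq ?_)
    ring
  have hbad : ∀ i < n, |P.truncationError n w g i| ≤ 13 * C ^ 5 * (2 * C + 1) * M * h ^ 2 := by
    intro i hi
    have hI : Icc ((i : ℝ) * h) ((i + 2 : ℝ) * h) ⊆ unitI := by
      obtain ⟨h1, h2⟩ := hmem i hi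
      exact Icc_subset_Icc (by linarith) (by linarith)
    have hx : (i + 1 : ℝ) * h ∈ unitI := hI ⟨by gcongr; linarith, by gcongr; norm_num⟩
    have aux : ∀ f : ℝ → ℝ, (∀ x ∈ unitI, |f x| ≤ C) →
        ∀ y ∈ Icc ((i : ℝ) * h) ((i + 2 : ℝ) * h), |f y - f ((i + 1) * h)| ≤ 2 * C := by
      intro f hf y hy
      linarith [abs_sub (f y) (f ((i + 1) * h)), hf y (hI hy), hf _ hx]
    refine (hT i hi (2 * C) (aux _ hC.θ_le) (aux _ hC.σ_le) (aux _ hC.lam_le)).trans ?_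
    calc _ ≤ 13 * C ^ 5 * M * (2 * C + 1) * h ^ 2 := by gcongr
      _ = _ := by ring
  have hle : ∀ i ∈ Finset.range n, |P.truncationError n w g i| ≤
      13 * C ^ 5 * (L + 1) * M * h ^ 2 * h +
        if i ∈ S₁ ∪ S₂ ∪ S₃ then 13 * C ^ 5 * (2 * C + 1) * M * h ^ 2 else 0 := by
    intro i hi
    rw [Finset.mem_range] at hi
    split_ifs with hiS
    · exact (hbad i hi).trans (le_add_of_nonneg_left (by positivity))
    · simpa using hgood i hi hiS
  refine (Finset.sum_le_sum hle).trans ?_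
  rw [Finset.sum_add_distrib, ← Finset.sum_filter]
  simp only [Finset.sum_const, nsmul_eq_mul, Finset.card_range]
  have hn : (n : ℝ) * h ≤ 1 := (node_mem (n := n) (i := n) (by omega)).2
  have hcard : (({i ∈ Finset.range n | i ∈ S₁ ∪ S₂ ∪ S₃}.card : ℕ) : ℝ) ≤ N₁ + N₂ + N₃ := by
    have h1 : {i ∈ Finset.range n | i ∈ S₁ ∪ S₂ ∪ S₃} ⊆ S₁ ∪ S₂ ∪ S₃ :=
      fun i hi => (Finset.mem_filter.1 hi).2
    have h2 := Finset.card_le_card h1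
    have h3 := Finset.card_union_le (S₁ ∪ S₂) S₃
    have h4 := Finset.card_union_le S₁ S₂
    exact_mod_cast (by omega :
      ({i ∈ Finset.range n | i ∈ S₁ ∪ S₂ ∪ S₃}.card : ℕ) ≤ N₁ + N₂ + N₃)
  calc _ = 13 * C ^ 5 * (L + 1) * M * h ^ 2 * (n * h) +
        (({i ∈ Finset.range n | i ∈ S₁ ∪ S₂ ∪ S₃}.card : ℕ) : ℝ) *
          (13 * C ^ 5 * (2 * C + 1) * M * h ^ 2) := by ring
    _ ≤ 13 * C ^ 5 * (L + 1) * M * h ^ 2 * 1 +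
        (N₁ + N₂ + N₃) * (13 * C ^ 5 * (2 * C + 1) * M * h ^ 2) := by gcongr
    _ = _ := by ring

end Coeffs

/-! ### Consistency at the left boundary -/

theorem tendsto_step : Tendsto step atTop (𝓝 0) := tendsto_one_div_add_atTop_nhds_zero_nat

theorem step_le_one (n : ℕ) : step n ≤ 1 := by
  have h := step_mul n
  have h0 := step_pos n
  have : (0 : ℝ) ≤ n := n.cast_nonneg
  nlinarith

namespace Coeffs

variable {P : Coeffs}

/-- The denominators occurring at the left boundary do not degenerate for small step sizes. -/
theorem Admissible.eventually_boundary (hP : P.Admissible) :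
    ∀ᶠ n in atTop, P.α₀ - step n * P.β₀ ≠ 0 ∧ 3 * P.α₀ - 2 * step n * P.β₀ ≠ 0 ∧
      1 - P.r₀ n ≠ 0 ∧ |(1 - P.r₀ n)⁻¹| ≤ 2 := by
  by_cases ha : P.α₀ = 0
  · have hb : P.β₀ ≠ 0 := hP.bc₀.resolve_left (not_not.2 ha)
    refine .of_forall fun n => ?_
    have h := (step_pos n).ne'
    simp [ha, hb, h, r₀]
  · have h1 : Tendsto (fun n => step n * |P.β₀|) atTop (𝓝 0) := by
      simpa using tendsto_step.mul_const |P.β₀|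
    have h2 : (0 : ℝ) < |P.α₀| / 2 := by positivity
    filter_upwards [h1.eventually_lt_const h2] with n hn
    have hh := step_pos n
    set h := step n with hdef
    have e1 : |h * P.β₀| = h * |P.β₀| := by rw [abs_mul, abs_of_pos hh]
    have e2 : |P.α₀| / 2 < |P.α₀ - h * P.β₀| := by
      have := abs_sub_abs_le_abs_sub P.α₀ (h * P.β₀)
      linarith
    have k1 : P.α₀ - h * P.β₀ ≠ 0 := abs_pos.1 (h2.trans e2)
    have k2 : 3 * P.α₀ - 2 * h * P.β₀ ≠ 0 := by
      have := abs_sub_abs_le_abs_sub (3 * P.α₀) (2 * (h * P.β₀))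
      rw [abs_mul, abs_mul, abs_of_pos (by norm_num : (0 : ℝ) < 3),
        abs_of_pos (by norm_num : (0 : ℝ) < 2)] at this
      refine abs_pos.1 ?_
      rw [mul_assoc]
      linarith
    have e3 : 1 - P.r₀ n = 2 * (P.α₀ - h * P.β₀) / (3 * P.α₀ - 2 * h * P.β₀) := by
      have hr : P.r₀ n * (3 * P.α₀ - 2 * h * P.β₀) = P.α₀ := div_mul_cancel₀ _ k2
      rw [eq_div_iff k2]
      linear_combination -hr
    have k3 : 1 - P.r₀ n ≠ 0 := by rw [e3]; positivity
    refine ⟨k1, k2, k3, ?_⟩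
    have e4 : (1 - P.r₀ n)⁻¹ = 1 + P.α₀ / 2 / (P.α₀ - h * P.β₀) := by
      rw [e3, inv_div, show 3 * P.α₀ - 2 * h * P.β₀ = 2 * (P.α₀ - h * P.β₀) + P.α₀ by ring]
      field_simp
    rw [e4]
    refine (abs_add_le _ _).trans ?_
    rw [abs_div, abs_div, abs_one, abs_of_pos (by norm_num : (0 : ℝ) < 2)]
    have : |P.α₀| / 2 / |P.α₀ - h * P.β₀| ≤ 1 := (div_le_one (h2.trans e2)).2 e2.le
    linarith

set_option maxHeartbeats 1000000 in
/-- The difference scheme is consistent of first order at its first two nodes. -/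
theorem Admissible.exists_initial_error_le (hP : P.Admissible) :
    ∃ A : ℝ, 0 ≤ A ∧ ∀ᶠ n in atTop, ∀ (w g : ℝ → ℝ) (M v₁ v₁' v₂ : ℝ), IsH2 w →
      P.opA w =ᵐ[vol01] g →
      (∀ x ∈ unitI, |w x| ≤ M) → (∀ x ∈ unitI, |dx w x| ≤ M) →
      (∀ x ∈ unitI, |g x| ≤ M) → (∀ x ∈ unitI, |dx g x| ≤ M) →
      P.α₀ * dx w 0 + P.β₀ * w 0 = 0 →
      v₁ = (P.α₀ * w 0 - P.β₀ * dx w 0) / (P.α₀ - P.q₀ n * P.β₀) →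
      v₁' = (P.α₀ * g 0 - P.β₀ * dx g 0) / (P.α₀ - P.q₀ n * P.β₀) →
      v₂ = step n ^ 2 / ((1 - P.r₀ n) * P.θ (step n)) * v₁'
        - (step n ^ 2 * (P.σ (step n) * P.q₀ n + P.lam (step n))
            + (4 * P.r₀ n - 2) * P.θ (step n)) / ((1 - P.r₀ n) * P.θ (step n)) * v₁ →
      |w (step n) - v₁| ≤ A * M * step n ∧
        |(w (2 * step n) - v₂) - (w (step n) - v₁)| ≤ A * M * step n ^ 2 := by
  obtain ⟨C, hC⟩ := hP.exists_bounds
  have hC1 := hC.one_le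
  set B := |P.α₀| + |P.β₀| with hB
  -- Up to sign, the determinant of the linear system that recovers `w 0` and `dx w 0` from the
  -- boundary condition and the end point value `e`.
  set N := P.α₀ ^ 2 + P.β₀ ^ 2 with hN
  have hN0 : 0 < N := by
    rcases hP.bc₀ with h | h <;> positivity
  refine ⟨15 * C ^ 2 + 2 * B ^ 4 / N ^ 2 + 2 * C * (1 + 2 * C) * (2 * B ^ 2 / N), by positivity, ?_⟩
  -- `n ≥ 1` keeps the second node `2h` inside `[0,1]`.
  filter_upwards [hP.eventually_boundary, eventually_ge_atTop 1] with n hn hn1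
    w g M v₁ v₁' v₂ hw hwg hM hM' hgM hgM' hbc hv₁ hv₁' hv₂
  obtain ⟨k1, k2, k3, k4⟩ := hn
  have hh := step_pos n
  have hh1 := step_le_one n
  have m0 : (0 : ℝ) ∈ unitI := ⟨le_rfl, zero_le_one⟩
  have m1 : step n ∈ unitI := ⟨hh.le, hh1⟩
  have m2 : 2 * step n ∈ unitI := by
    have := node_mem (n := n) (i := 2) (by omega)
    exact_mod_cast this
  set h := step n with hdef
  have hM0 : 0 ≤ M := (abs_nonneg _).trans (hM 0 m0)
  have hθ := hC.θ_pos h m1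
  have t1 := (hC.taylor hw hwg hM hM' hgM m0 m1).2
  have t2 := (hC.taylor hw hwg hM hM' hgM m0 m2).2
  simp only [sub_zero] at t1 t2
  -- The discrete counterpart of `N`: it equals `(α₀ - q₀ β₀)(α₀ - h β₀)`. The difference `X` below
  -- is `O(h)` because `N - Nh = h α₀ β₀`.
  set Nh := N - h * P.α₀ * P.β₀ with hNh
  have hNhN : N / 2 ≤ Nh := by
    have : h * (2 * (P.α₀ * P.β₀)) ≤ 1 * N := by
      refine (le_abs_self _).trans ?_
      rw [abs_mul, abs_of_pos hh]
      refine mul_le_mul hh1 ?_ (abs_nonneg _) zero_le_one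
      rw [abs_le]
      constructor <;> nlinarith [sq_nonneg (P.α₀ + P.β₀), sq_nonneg (P.α₀ - P.β₀)]
    linarith
  have hNh0 : 0 < Nh := by linarith
  have hq : P.q₀ n * (P.α₀ - h * P.β₀) = -P.β₀ := div_mul_cancel₀ _ k1
  have hr : P.r₀ n * (3 * P.α₀ - 2 * h * P.β₀) = P.α₀ := div_mul_cancel₀ _ k2
  have hden : P.α₀ - P.q₀ n * P.β₀ = Nh / (P.α₀ - h * P.β₀) := by
    rw [eq_div_iff k1, hNh, hN]
    linear_combination -P.β₀ * hq
  set e := P.α₀ * w 0 - P.β₀ * dx w 0 with he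
  set e' := P.α₀ * g 0 - P.β₀ * dx g 0 with he'
  have habs : ∀ p q : ℝ, |p| ≤ M → |q| ≤ M → |P.α₀ * p - P.β₀ * q| ≤ B * M := by
    intro p q hp hq
    refine (abs_sub _ _).trans ?_
    rw [abs_mul, abs_mul, hB, add_mul]
    gcongr
  have heM : |e| ≤ B * M := habs _ _ (hM 0 m0) (hM' 0 m0)
  have heM' : |e'| ≤ B * M := habs _ _ (hgM 0 m0) (hgM' 0 m0)
  have hα : |P.α₀| ≤ B := by rw [hB]; linarith [abs_nonneg P.β₀]
  have hβ : |P.β₀| ≤ B := by rw [hB]; linarith [abs_nonneg P.α₀]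
  have hαβ : |P.α₀ - h * P.β₀| ≤ B := by
    refine (abs_sub _ _).trans ?_
    rw [abs_mul, abs_of_pos hh, hB]
    gcongr
    exact mul_le_of_le_one_left (abs_nonneg _) hh1
  have hw0 : w 0 = P.α₀ * e / N := by
    rw [eq_div_iff hN0.ne', hN, he]
    linear_combination P.β₀ * hbc
  have hw1 : dx w 0 = -P.β₀ * e / N := by
    rw [eq_div_iff hN0.ne', hN, he]
    linear_combination P.α₀ * hbc
  have ev₁ : v₁ = (P.α₀ - h * P.β₀) * (e / Nh) := by
    rw [hv₁, hden, div_div_eq_mul_div]; ring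
  have ev₁' : v₁' = (P.α₀ - h * P.β₀) * (e' / Nh) := by
    rw [hv₁', hden, div_div_eq_mul_div]; ring
  have eqv : P.q₀ n * v₁ = -P.β₀ * (e / Nh) := by
    rw [ev₁]; linear_combination (e / Nh) * hq
  set X := e / N - e / Nh with hX
  have hXM : |X| ≤ 2 * B ^ 3 / N ^ 2 * M * h := by
    have : X = -(e * (h * (P.α₀ * P.β₀))) / (N * Nh) := by
      rw [hX]; field_simp; rw [hNh]; ring
    rw [this, abs_div, abs_neg, abs_mul, abs_mul, abs_mul, abs_of_pos hh,
      abs_of_pos (mul_pos hN0 hNh0)]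
    calc _ ≤ B * M * (h * (B * B)) / (N * (N / 2)) := by gcongr
      _ = _ := by field_simp
  have hdiv : ∀ z : ℝ, |z| ≤ B * M → |z / Nh| ≤ 2 * B / N * M := by
    intro z hz
    rw [abs_div, abs_of_pos hNh0]
    calc _ ≤ B * M / (N / 2) := by gcongr
      _ = _ := by field_simp
  have bv₁ : |v₁| ≤ 2 * B ^ 2 / N * M := by
    rw [ev₁, abs_mul]
    calc _ ≤ B * (2 * B / N * M) := by gcongr; exact hdiv e heM
      _ = _ := by ring
  have bv₁' : |v₁'| ≤ 2 * B ^ 2 / N * M := by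
    rw [ev₁', abs_mul]
    calc _ ≤ B * (2 * B / N * M) := by gcongr; exact hdiv e' heM'
      _ = _ := by ring
  have bqv : |P.q₀ n * v₁| ≤ 2 * B ^ 2 / N * M := by
    rw [eqv, abs_mul, abs_neg]
    calc _ ≤ B * (2 * B / N * M) := by gcongr; exact hdiv e heM
      _ = _ := by ring
  have hh2 : h ^ 2 ≤ h := by rw [sq]; exact mul_le_of_le_one_left hh.le hh1
  constructor
  · have e1 : w h - v₁ = (w h - w 0 - dx w 0 * h) + (P.α₀ - h * P.β₀) * X := by
      rw [ev₁, hw0, hw1, hX]; ring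
    rw [e1]
    refine (abs_add_le _ _).trans ?_
    rw [abs_mul]
    have p1 : 3 * C ^ 2 * M * h ^ 2 ≤ 15 * C ^ 2 * M * h := by
      gcongr; norm_num
    have p2 : |P.α₀ - h * P.β₀| * |X| ≤ B * (2 * B ^ 3 / N ^ 2 * M * h) := by gcongr
    have p3 : 0 ≤ 2 * C * (1 + 2 * C) * (2 * B ^ 2 / N) * M * h := by positivity
    calc _ ≤ 15 * C ^ 2 * M * h + B * (2 * B ^ 3 / N ^ 2 * M * h) +
          2 * C * (1 + 2 * C) * (2 * B ^ 2 / N) * M * h := by linarith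
      _ = _ := by ring
  · have e2 : v₂ - v₁ = h * (P.q₀ n * v₁) + h ^ 2 * ((1 - P.r₀ n)⁻¹ * ((P.θ h)⁻¹ *
        (v₁' - P.σ h * (P.q₀ n * v₁) - P.lam h * v₁))) := by
      have e3 : 1 - 3 * P.r₀ n = h * P.q₀ n * (1 - P.r₀ n) := by
        refine mul_right_cancel₀ k2 ?_
        linear_combination (-3 - h * P.q₀ n * -1) * hr - 2 * h * hq
      have hp := mul_inv_cancel₀ k3
      have ht := mul_inv_cancel₀ hθ.ne'
      rw [hv₂, div_eq_mul_inv, div_eq_mul_inv, mul_inv]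
      linear_combination -(4 * P.r₀ n - 2) * (1 - P.r₀ n)⁻¹ * v₁ * ht
        + v₁ * (1 - P.r₀ n)⁻¹ * e3 + v₁ * (1 + h * P.q₀ n) * hp
    have e1 : (w (2 * h) - v₂) - (w h - v₁) = (w (2 * h) - w 0 - dx w 0 * (2 * h))
        - (w h - w 0 - dx w 0 * h) - h * (P.β₀ * X)
        - h ^ 2 * ((1 - P.r₀ n)⁻¹ * ((P.θ h)⁻¹ *
        (v₁' - P.σ h * (P.q₀ n * v₁) - P.lam h * v₁))) := by
      have : (w (2 * h) - v₂) - (w h - v₁) = w (2 * h) - w h - (v₂ - v₁) := by ring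
      rw [this, e2, eqv, hw1, hX]
      ring
    rw [e1]
    have q1 : |h * (P.β₀ * X)| ≤ h * (B * (2 * B ^ 3 / N ^ 2 * M * h)) := by
      rw [abs_mul, abs_mul, abs_of_pos hh]; gcongr
    have q2 : |h ^ 2 * ((1 - P.r₀ n)⁻¹ * ((P.θ h)⁻¹ *
        (v₁' - P.σ h * (P.q₀ n * v₁) - P.lam h * v₁)))| ≤
        h ^ 2 * (2 * (C * (2 * B ^ 2 / N * M + C * (2 * B ^ 2 / N * M)
          + C * (2 * B ^ 2 / N * M)))) := by
      rw [abs_mul, abs_mul, abs_mul, abs_of_pos (pow_pos hh 2), abs_of_pos (inv_pos.2 hθ)]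
      gcongr
      · exact hC.θ_inv h m1
      · refine (abs_sub _ _).trans (add_le_add ((abs_sub _ _).trans (add_le_add bv₁' ?_)) ?_)
        · rw [abs_mul]; gcongr; exact hC.σ_le h m1
        · rw [abs_mul]; gcongr; exact hC.lam_le h m1
    have s1 := abs_sub ((w (2 * h) - w 0 - dx w 0 * (2 * h))
        - (w h - w 0 - dx w 0 * h) - h * (P.β₀ * X)) (h ^ 2 * ((1 - P.r₀ n)⁻¹ * ((P.θ h)⁻¹ *
        (v₁' - P.σ h * (P.q₀ n * v₁) - P.lam h * v₁))))
    have s2 := abs_sub ((w (2 * h) - w 0 - dx w 0 * (2 * h))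
        - (w h - w 0 - dx w 0 * h)) (h * (P.β₀ * X))
    have s3 := abs_sub (w (2 * h) - w 0 - dx w 0 * (2 * h)) (w h - w 0 - dx w 0 * h)
    calc _ ≤ 3 * C ^ 2 * M * (2 * h) ^ 2 + 3 * C ^ 2 * M * h ^ 2
          + h * (B * (2 * B ^ 3 / N ^ 2 * M * h))
          + h ^ 2 * (2 * (C * (2 * B ^ 2 / N * M + C * (2 * B ^ 2 / N * M)
          + C * (2 * B ^ 2 / N * M)))) := by linarith
      _ = _ := by ring

end Coeffs

/-! ### Time derivatives of the flat trajectory and the error recursion -/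

theorem contRep_ae_eq (g : ℝ → ℝ) : contRep g =ᵐ[vol01] g := by
  unfold contRep
  split_ifs with H
  · exact H.choose_spec.2
  · rfl

theorem contDiffOn_derivWithin_Icc {T : ℝ} (hT : 0 < T) {f : ℝ → ℝ}
    (hf : ContDiffOn ℝ ∞ f (Icc 0 T)) : ContDiffOn ℝ ∞ (derivWithin f (Icc 0 T)) (Icc 0 T) :=
  hf.derivWithin (uniqueDiffOn_Icc hT) (by norm_num)

theorem iteratedDerivWithin_linear_combination {T t : ℝ} (hT : 0 < T) (ht : t ∈ Icc 0 T)
    {f g : ℝ → ℝ} (hf : ContDiffOn ℝ ∞ f (Icc 0 T)) (hg : ContDiffOn ℝ ∞ g (Icc 0 T))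
    (a b c : ℝ) (k : ℕ) :
    iteratedDerivWithin k (fun s => a * derivWithin f (Icc 0 T) s + b * g s + c * f s)
      (Icc 0 T) t = a * iteratedDerivWithin (k + 1) f (Icc 0 T) t
        + b * iteratedDerivWithin k g (Icc 0 T) t + c * iteratedDerivWithin k f (Icc 0 T) t := by
  have hs := uniqueDiffOn_Icc hT
  have hk : ∀ {f : ℝ → ℝ}, ContDiffOn ℝ ∞ f (Icc 0 T) →
      ContDiffWithinAt ℝ k f (Icc 0 T) t := fun hf =>
    (hf t ht).of_le (by exact_mod_cast le_top)
  have h1 := hk ((contDiffOn_const (c := a)).mul (contDiffOn_derivWithin_Icc hT hf))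
  have h2 := hk ((contDiffOn_const (c := b)).mul hg)
  have h3 := hk ((contDiffOn_const (c := c)).mul hf)
  rw [iteratedDerivWithin_fun_add ht hs (h1.add h2) h3, iteratedDerivWithin_fun_add ht hs h1 h2,
    iteratedDerivWithin_const_mul_field, iteratedDerivWithin_const_mul_field,
    iteratedDerivWithin_const_mul_field, iteratedDerivWithin_succ']

namespace Coeffs

variable {P : Coeffs} {T : ℝ} {y : ℝ → ℝ}

theorem flat_contDiffOn (hT : 0 < T) (hy : ContDiffOn ℝ ∞ y (Icc 0 T)) (n : ℕ) :
    ∀ j, ContDiffOn ℝ ∞ (P.flat T y n j) (Icc 0 T)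
  | 0 => contDiffOn_const
  | 1 => hy.div_const _
  | 2 => (contDiffOn_const.mul (contDiffOn_derivWithin_Icc hT (flat_contDiffOn hT hy n 1))).sub
      (contDiffOn_const.mul (flat_contDiffOn hT hy n 1))
  | i + 3 => ((contDiffOn_const.mul
      (contDiffOn_derivWithin_Icc hT (flat_contDiffOn hT hy n (i + 2)))).add
      (contDiffOn_const.mul (flat_contDiffOn hT hy n (i + 1)))).add
      (contDiffOn_const.mul (flat_contDiffOn hT hy n (i + 2)))

/-- The `k`-th time derivative at `t` of the `j`-th component of the semi-discrete flat
trajectory. -/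
noncomputable def flatDeriv (P : Coeffs) (T : ℝ) (y : ℝ → ℝ) (n : ℕ) (t : ℝ) (k j : ℕ) : ℝ :=
  iteratedDerivWithin k (P.flat T y n j) (Icc 0 T) t

variable {t : ℝ}

theorem flatDeriv_one (n k : ℕ) : P.flatDeriv T y n t k 1 =
    iteratedDerivWithin k y (Icc 0 T) t / (P.α₀ - P.q₀ n * P.β₀) := by
  simp only [flatDeriv, flat, div_eq_inv_mul]
  rw [iteratedDerivWithin_const_mul_field]

theorem flatDeriv_two (hT : 0 < T) (ht : t ∈ Icc 0 T) (hy : ContDiffOn ℝ ∞ y (Icc 0 T))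
    (n k : ℕ) : P.flatDeriv T y n t k 2 =
      step n ^ 2 / ((1 - P.r₀ n) * P.θ (step n)) * P.flatDeriv T y n t (k + 1) 1
        - (step n ^ 2 * (P.σ (step n) * P.q₀ n + P.lam (step n))
            + (4 * P.r₀ n - 2) * P.θ (step n)) / ((1 - P.r₀ n) * P.θ (step n)) *
          P.flatDeriv T y n t k 1 := by
  have := iteratedDerivWithin_linear_combination hT ht (P.flat_contDiffOn hT hy n 1)
    (P.flat_contDiffOn hT hy n 1) (step n ^ 2 / ((1 - P.r₀ n) * P.θ (step n)))
    (-((step n ^ 2 * (P.σ (step n) * P.q₀ n + P.lam (step n))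
            + (4 * P.r₀ n - 2) * P.θ (step n)) / ((1 - P.r₀ n) * P.θ (step n)))) 0 k
  simp only [zero_mul, add_zero, neg_mul, ← sub_eq_add_neg] at this
  exact this

/-- The defining recursion, multiplied back by `θ`, has the form of `truncationError` with value
zero, so subtracting the two gives the difference equation of the error. -/
theorem flatDeriv_add_three (hT : 0 < T) (ht : t ∈ Icc 0 T) (hy : ContDiffOn ℝ ∞ y (Icc 0 T))
    {n i : ℕ} (hθ : P.θ ((i + 2) * step n) ≠ 0) (k : ℕ) :
    P.θ ((i + 2) * step n) * (P.flatDeriv T y n t k (i + 3) - 2 * P.flatDeriv T y n t k (i + 2)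
        + P.flatDeriv T y n t k (i + 1))
      + step n * P.σ ((i + 2) * step n) *
        (P.flatDeriv T y n t k (i + 2) - P.flatDeriv T y n t k (i + 1))
      + step n ^ 2 * (P.lam ((i + 2) * step n) * P.flatDeriv T y n t k (i + 2)
        - P.flatDeriv T y n t (k + 1) (i + 2)) = 0 := by
  have := iteratedDerivWithin_linear_combination hT ht (P.flat_contDiffOn hT hy n (i + 2))
    (P.flat_contDiffOn hT hy n (i + 1)) (step n ^ 2 / P.θ ((i + 2) * step n))
    ((step n * P.σ ((i + 2) * step n) - P.θ ((i + 2) * step n)) / P.θ ((i + 2) * step n))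
    ((2 * P.θ ((i + 2) * step n) - step n * P.σ ((i + 2) * step n)
      - step n ^ 2 * P.lam ((i + 2) * step n)) / P.θ ((i + 2) * step n)) k
  have e : P.flatDeriv T y n t k (i + 3) = _ := this
  rw [e]
  simp only [flatDeriv]
  field_simp
  ring

/-- The error of the semi-discrete flat trajectory at the nodes: one level of the hierarchy of time
derivatives is bounded by the next one. -/
theorem Admissible.exists_error_recursion (hP : P.Admissible) :
    ∃ K : ℝ, 0 ≤ K ∧ ∀ᶠ n in atTop, ∀ (T t : ℝ) (y : ℝ → ℝ) (W : ℕ → ℝ → ℝ) (M : ℕ → ℝ),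
      0 < T → t ∈ Icc 0 T → ContDiffOn ℝ ∞ y (Icc 0 T) →
      (∀ k, IsH2 (W k)) → (∀ k, P.opA (W k) =ᵐ[vol01] W (k + 1)) →
      (∀ k, P.α₀ * dx (W k) 0 + P.β₀ * W k 0 = 0) →
      (∀ k, iteratedDerivWithin k y (Icc 0 T) t = P.α₀ * W k 0 - P.β₀ * dx (W k) 0) →
      (∀ k, ∀ x ∈ unitI, |W k x| ≤ M k ∧ |dx (W k) x| ≤ M k ∧ |W (k + 1) x| ≤ M k ∧
        |dx (W (k + 1)) x| ≤ M k) →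
      ∀ k, ∀ j < n, |W k ((j + 1) * step n) - P.flatDeriv T y n t k (j + 1)| ≤
        K * (step n * M k + step n ^ 2 * ∑ i ∈ Finset.range j, ∑ l ∈ Finset.range (i + 1),
          |W (k + 1) ((l + 1) * step n) - P.flatDeriv T y n t (k + 1) (l + 1)|) := by
  obtain ⟨C, hC⟩ := hP.exists_bounds
  have hC1 := hC.one_le
  obtain ⟨K₁, hK₁, hτ⟩ := hP.exists_sum_truncationError_le
  obtain ⟨A, hA, hinit⟩ := hP.exists_initial_error_le
  set X := Real.exp (2 * C ^ 2 + 1) with hX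
  have hX1 : 1 ≤ X := Real.one_le_exp (by positivity)
  refine ⟨A + X * (2 * A + C ^ 2 * K₁ + C ^ 2), by positivity, ?_⟩
  filter_upwards [hinit] with n hn T t y W M hT ht hy hW hWA hbc hyW hM k j hj
  have hh := step_pos n
  have hh1 := step_le_one n
  have hM0 : 0 ≤ M k := (abs_nonneg _).trans (hM k 0 ⟨le_rfl, zero_le_one⟩).1
  -- Index `j` belongs to the node `(j + 1) h`.
  set E : ℕ → ℕ → ℝ := fun k j =>
    W k ((j + 1) * step n) - P.flatDeriv T y n t k (j + 1) with hE
  have hinit := hn (W k) (W (k + 1)) (M k) (P.flatDeriv T y n t k 1)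
    (P.flatDeriv T y n t (k + 1) 1) (P.flatDeriv T y n t k 2) (hW k) (hWA k)
    (fun x hx => (hM k x hx).1) (fun x hx => (hM k x hx).2.1)
    (fun x hx => (hM k x hx).2.2.1) (fun x hx => (hM k x hx).2.2.2) (hbc k)
    (by rw [flatDeriv_one, hyW]) (by rw [flatDeriv_one, hyW]) (flatDeriv_two hT ht hy n k)
  have hτ := hτ n (W k) (W (k + 1)) (M k) (hW k) (hW (k + 1)) (hWA k)
    (fun x hx => (hM k x hx).1) (fun x hx => (hM k x hx).2.1)
    (fun x hx => (hM k x hx).2.2.1) (fun x hx => (hM k x hx).2.2.2)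
  set τ : ℕ → ℝ := fun i => |P.truncationError n (W k) (W (k + 1)) i| with hτdef
  have hnh : (n : ℝ) * step n ≤ 1 := (node_mem (n := n) (i := n) (by omega)).2
  have e0 : |E k 0| ≤ A * M k * step n := by simpa [hE] using hinit.1
  have e1 : |E k 1 - E k 0| ≤ step n * (A * M k * step n) := by
    have e : E k 1 - E k 0 = W k (2 * step n) - P.flatDeriv T y n t k 2 -
        (W k (step n) - P.flatDeriv T y n t k 1) := by
      simp only [hE]; norm_num
    rw [e]
    refine hinit.2.trans (le_of_eq (by ring))
  -- The source is the next level plus the truncation error over `h²`. In `c = C ^ 2` one factor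
  -- bounds `1/θ`, the other the remaining coefficients.
  have main := abs_le_of_second_difference_le (n := n) (h := step n) (c := C ^ 2)
    (a := A * M k * step n) (E := E k) (F := fun l => |E (k + 1) l| + τ l / step n ^ 2)
    hh.le hh1 (by positivity) (by positivity) hnh (fun i => by positivity) e0 (fun _ => e1)
    (fun i hi => by
      have hx : (i + 2 : ℝ) * step n ∈ unitI := by
        have := node_mem (n := n) (i := i + 2) (by omega)
        exact_mod_cast this
      have hs := flatDeriv_add_three hT ht hy (hC.θ_pos _ hx).ne' k
      have hτi : P.truncationError n (W k) (W (k + 1)) (i + 1) =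
          P.θ ((i + 2) * step n) * (W k ((i + 3) * step n) - 2 * W k ((i + 2) * step n)
            + W k ((i + 1) * step n))
          + step n * P.σ ((i + 2) * step n) * (W k ((i + 2) * step n) - W k ((i + 1) * step n))
          + step n ^ 2 * (P.lam ((i + 2) * step n) * W k ((i + 2) * step n)
            - W (k + 1) ((i + 2) * step n)) := by
        unfold truncationError
        push_cast
        rw [show (i : ℝ) + 1 + 1 = i + 2 by ring, show (i : ℝ) + 1 + 2 = i + 3 by ring]
      have hE0 : E k i = W k ((i + 1) * step n) - P.flatDeriv T y n t k (i + 1) := rfl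
      have hE1 : ∀ k, E k (i + 1) = W k ((i + 2) * step n) - P.flatDeriv T y n t k (i + 2) := by
        intro k
        simp only [hE]
        push_cast
        rw [show (i : ℝ) + 1 + 1 = i + 2 by ring]
      have hE2 : E k (i + 2) = W k ((i + 3) * step n) - P.flatDeriv T y n t k (i + 3) := by
        simp only [hE]
        push_cast
        rw [show (i : ℝ) + 2 + 1 = i + 3 by ring]
      have e : P.θ ((i + 2) * step n) * (E k (i + 2) - 2 * E k (i + 1) + E k i) =
          P.truncationError n (W k) (W (k + 1)) (i + 1)
          - step n * P.σ ((i + 2) * step n) * (E k (i + 1) - E k i)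
          - step n ^ 2 * P.lam ((i + 2) * step n) * E k (i + 1) + step n ^ 2 * E (k + 1) (i + 1) := by
        rw [hE2, hE1, hE1, hE0, hτi]
        linear_combination -hs
      refine (hC.abs_le_of_mul_eq hx e).trans ?_
      have b1 : |step n * P.σ ((i + 2) * step n) * (E k (i + 1) - E k i)| ≤
          step n * C * |E k (i + 1) - E k i| := by
        rw [abs_mul, abs_mul, abs_of_pos hh]; gcongr; exact hC.σ_le _ hx
      have b2 : |step n ^ 2 * P.lam ((i + 2) * step n) * E k (i + 1)| ≤
          step n ^ 2 * C * |E k (i + 1)| := by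
        rw [abs_mul, abs_mul, abs_of_pos (pow_pos hh 2)]; gcongr; exact hC.lam_le _ hx
      have b3 : |step n ^ 2 * E (k + 1) (i + 1)| = step n ^ 2 * |E (k + 1) (i + 1)| := by
        rw [abs_mul, abs_of_pos (pow_pos hh 2)]
      have t : ∀ a b c d : ℝ, |a - b - c + d| ≤ |a| + |b| + |c| + |d| := by
        intro a b c d
        linarith [abs_add_le (a - b - c) d, abs_sub (a - b) c, abs_sub a b]
      have b4 : step n ^ 2 * |E (k + 1) (i + 1)| ≤ C * (step n ^ 2 * |E (k + 1) (i + 1)|) :=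
        le_mul_of_one_le_left (by positivity) hC1
      have b5 : τ (i + 1) ≤ C * τ (i + 1) := le_mul_of_one_le_left (abs_nonneg _) hC1
      calc _ ≤ C * (C * τ (i + 1) + step n * C * |E k (i + 1) - E k i| +
            step n ^ 2 * C * |E k (i + 1)| + C * (step n ^ 2 * |E (k + 1) (i + 1)|)) := by
            gcongr
            refine (t _ _ _ _).trans ?_
            rw [b3]
            gcongr
        _ = _ := by field_simp; ring) hj
  refine main.trans ?_
  -- Each inner sum of `τ / h²` is at most `K₁ M_k`, and there are `j ≤ 1/h` of them, so the
  -- prefactor `h²` leaves `O(h)`.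
  have hsum : step n ^ 2 * ∑ i ∈ Finset.range j, ∑ l ∈ Finset.range (i + 1),
      (|E (k + 1) l| + τ l / step n ^ 2) ≤ K₁ * M k * step n + step n ^ 2 *
        ∑ i ∈ Finset.range j, ∑ l ∈ Finset.range (i + 1), |E (k + 1) l| := by
    have h1 : ∀ i ∈ Finset.range j, ∑ l ∈ Finset.range (i + 1),
        (|E (k + 1) l| + τ l / step n ^ 2) ≤
        ∑ l ∈ Finset.range (i + 1), |E (k + 1) l| + K₁ * M k := by
      intro i hi
      rw [Finset.mem_range] at hi
      rw [Finset.sum_add_distrib, ← Finset.sum_div]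
      gcongr
      rw [div_le_iff₀ (by positivity)]
      refine le_trans ?_ hτ
      exact Finset.sum_le_sum_of_subset_of_nonneg (Finset.range_mono (by omega))
        fun _ _ _ => abs_nonneg _
    refine (mul_le_mul_of_nonneg_left (Finset.sum_le_sum h1) (by positivity)).trans ?_
    rw [Finset.sum_add_distrib, mul_add, add_comm]
    refine add_le_add ?_ le_rfl
    rw [Finset.sum_const, Finset.card_range, nsmul_eq_mul]
    have : (j : ℝ) * step n ≤ 1 := le_trans (by gcongr) hnh
    calc step n ^ 2 * (j * (K₁ * M k)) = (j * step n) * (K₁ * M k * step n) := by ring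
      _ ≤ 1 * (K₁ * M k * step n) := by gcongr
      _ = _ := one_mul _
  set S := ∑ i ∈ Finset.range j, ∑ l ∈ Finset.range (i + 1), |E (k + 1) l| with hS
  have hS0 : 0 ≤ S := Finset.sum_nonneg fun _ _ => Finset.sum_nonneg fun _ _ => abs_nonneg _
  have hS2 : 0 ≤ step n ^ 2 * S := by positivity
  have hMs : 0 ≤ step n * M k := by positivity
  calc _ ≤ A * M k * step n + X * (2 * (A * M k * step n) + C ^ 2 * (K₁ * M k * step n
        + step n ^ 2 * S)) := by
        rw [mul_assoc (C ^ 2)]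
        gcongr
    _ = A * (step n * M k) + X * (2 * A + C ^ 2 * K₁) * (step n * M k)
        + X * C ^ 2 * (step n ^ 2 * S) := by ring
    _ ≤ (A + X * (2 * A + C ^ 2 * K₁ + C ^ 2)) * (step n * M k)
        + (A + X * (2 * A + C ^ 2 * K₁ + C ^ 2)) * (step n ^ 2 * S) := by
        have p1 : 0 ≤ X * C ^ 2 * (step n * M k) := by positivity
        have p2 : 0 ≤ (A + X * (2 * A + C ^ 2 * K₁)) * (step n ^ 2 * S) := by positivity
        linarith
    _ = _ := by ring

end Coeffs

/-! ### Growth of the iterates and convergence -/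

theorem norm2d_le {n : ℕ} {v : Fin n → ℝ} {B : ℝ} (hB : 0 ≤ B) (hv : ∀ i, |v i| ≤ B) :
    norm2d v ≤ B := by
  have hh := step_pos n
  have hn : (n : ℝ) * step n ≤ 1 := (node_mem (n := n) (i := n) (by omega)).2
  have h1 : ∑ i, (v i) ^ 2 ≤ n * B ^ 2 := by
    calc ∑ i, (v i) ^ 2 ≤ ∑ _i : Fin n, B ^ 2 := Finset.sum_le_sum fun i _ => by
          rw [← sq_abs]; gcongr; exact hv i
      _ = _ := by simp
  rw [norm2d, ← Real.sqrt_mul hh.le]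
  refine Real.sqrt_le_iff.2 ⟨hB, ?_⟩
  calc _ ≤ step n * (n * B ^ 2) := by gcongr
    _ = (n * step n) * B ^ 2 := by ring
    _ ≤ 1 * B ^ 2 := by gcongr
    _ = _ := one_mul _

/-- An index shift in the Gevrey bound costs only a geometric factor, as `(k + 1)² ≤ 4^k`. -/
theorem factorial_succ_rpow_le {α : ℝ} (hα₂ : α ≤ 2) (k : ℕ) :
    ((k + 1)! : ℝ) ^ α ≤ 4 ^ k * (k ! : ℝ) ^ α := by
  rw [Nat.factorial_succ, Nat.cast_mul, Real.mul_rpow (by positivity) (by positivity)]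
  gcongr
  have h1 : ((k + 1 : ℕ) : ℝ) ≤ 2 ^ k := by exact_mod_cast Nat.lt_two_pow_self
  calc ((k + 1 : ℕ) : ℝ) ^ α ≤ ((k + 1 : ℕ) : ℝ) ^ (2 : ℝ) :=
        Real.rpow_le_rpow_of_exponent_le (by simp) hα₂
    _ = ((k + 1 : ℕ) : ℝ) ^ 2 := by norm_cast
    _ ≤ (2 ^ k) ^ 2 := by gcongr
    _ = 4 ^ k := by rw [← pow_mul, mul_comm, pow_mul]; norm_num

theorem le_rpow_factorial {α : ℝ} (hα : 1 ≤ α) (k : ℕ) : (k ! : ℝ) ≤ (k ! : ℝ) ^ α := by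
  have h1 : (1 : ℝ) ≤ k ! := by exact_mod_cast Nat.one_le_iff_ne_zero.2 k.factorial_ne_zero
  simpa using Real.rpow_le_rpow_of_exponent_le h1 hα

namespace Coeffs

variable {P : Coeffs} {u : ℝ → ℝ}

theorem IsState.isH2 (hu : P.IsState u) : ∀ k, IsH2 (P.powA k u)
  | 0 => hu.pc21.1
  | k + 1 => (hu.domain (k + 1) (by omega)).h2

theorem IsState.opA_ae_eq (k : ℕ) : P.opA (P.powA k u) =ᵐ[vol01] P.powA (k + 1) u :=
  (contRep_ae_eq _).symm

theorem IsState.left_powA (hu : P.IsState u) :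
    ∀ k, P.α₀ * dx (P.powA k u) 0 + P.β₀ * P.powA k u 0 = 0
  | 0 => hu.left
  | k + 1 => (hu.domain (k + 1) (by omega)).left

/-- The `C¹` norms of `𝒜^k u` grow at most like `(k!)^α` if the end point values do. -/
theorem IsState.exists_gevrey_bound (hP : P.Admissible) (hu : P.IsState u) {α D : ℝ}
    (hα : 1 ≤ α) (hD : 0 < D)
    (he : ∀ k, |P.endpointValue k u| ≤ D ^ (k + 1) * (k ! : ℝ) ^ α) :
    ∃ Q R : ℝ, 0 ≤ Q ∧ 1 ≤ R ∧ ∀ k, ∀ x ∈ unitI,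
      |P.powA k u x| + |dx (P.powA k u) x| ≤ Q * R ^ k * (k ! : ℝ) ^ α := by
  obtain ⟨C, hC⟩ := hP.exists_bounds
  have hC1 := hC.one_le
  obtain ⟨C₀, hC₀, hb⟩ := hu.bound
  set N := P.α₀ ^ 2 + P.β₀ ^ 2 with hN
  have hN0 : 0 < N := by
    rcases hP.bc₀ with h | h <;> positivity
  set B := (|P.α₀| + |P.β₀|) / N with hB
  set Z := 1 + D + C₀ with hZ
  have hZ1 : 1 ≤ Z := by linarith
  set X := Real.exp (C * C + 1) with hX
  -- `B` converts the end point value into Cauchy data and `Z` dominates both `D` and `C₀`; the `2`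
  -- absorbs the factor `k + 1 ≤ 2^k` of `(k + 1)!`.
  refine ⟨(B + C) * Z * X, 2 * Z, by positivity, by linarith, fun k x hx => ?_⟩
  have hbk := hb (k + 1) (by omega)
  refine (hC.apriori (hu.isH2 k) (hu.isH2 (k + 1)).continuousOn (IsState.opA_ae_eq k)
    (by positivity) hbk hx).trans ?_
  set w := P.powA k u with hw
  have hbc := hu.left_powA k
  rw [← hw] at hbc
  set e := P.endpointValue k u with hedef
  have hee : e = P.α₀ * w 0 - P.β₀ * dx w 0 := rfl
  have hw0 : w 0 = P.α₀ * e / N := by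
    rw [eq_div_iff hN0.ne', hN, hee]
    linear_combination P.β₀ * hbc
  have hw1 : dx w 0 = -P.β₀ * e / N := by
    rw [eq_div_iff hN0.ne', hN, hee]
    linear_combination P.α₀ * hbc
  have hdata : |w 0| + |dx w 0| = B * |e| := by
    rw [hw0, hw1, abs_div, abs_div, abs_mul, abs_mul, abs_neg, abs_of_pos hN0, hB]
    ring
  rw [hdata]
  have b1 : |e| ≤ Z ^ (k + 1) * 2 ^ k * (k ! : ℝ) ^ α := by
    refine (he k).trans ?_
    gcongr
    calc D ^ (k + 1) ≤ Z ^ (k + 1) := by gcongr; linarith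
      _ ≤ Z ^ (k + 1) * 2 ^ k := le_mul_of_one_le_right (by positivity) (one_le_pow₀ (by norm_num))
  have b2 : C₀ ^ (k + 1) * ((k + 1)! : ℝ) ≤ Z ^ (k + 1) * 2 ^ k * (k ! : ℝ) ^ α := by
    rw [mul_assoc]
    have h1 : ((k + 1 : ℕ) : ℝ) ≤ 2 ^ k := by exact_mod_cast Nat.lt_two_pow_self
    rw [Nat.factorial_succ, Nat.cast_mul]
    have h2 : C₀ ^ (k + 1) ≤ Z ^ (k + 1) := by gcongr; linarith
    have h3 := le_rpow_factorial hα k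
    gcongr
  calc _ ≤ (B * (Z ^ (k + 1) * 2 ^ k * (k ! : ℝ) ^ α)
        + C * (Z ^ (k + 1) * 2 ^ k * (k ! : ℝ) ^ α)) * X := by gcongr
    _ = _ := by rw [mul_pow]; ring

/-- The common form of the two limits. The proof bounds every component of the error by `h` times
the sum of a convergent series independent of `n`. -/
theorem tendsto_norm2d_sample_sub_flatState (hP : P.Admissible) (hu : P.IsState u) {T t α : ℝ}
    (hT : 0 < T) (ht : t ∈ Icc 0 T) (hα₁ : 1 < α) (hα₂ : α < 2) {y : ℝ → ℝ} (hy : IsGevrey α T y)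
    (hyu : ∀ m : ℕ, iteratedDerivWithin m y (Icc 0 T) t = P.endpointValue m u) :
    Tendsto (fun n : ℕ => norm2d (sample n u - P.flatState T y n t)) atTop (𝓝 0) := by
  obtain ⟨hyC, D, hD, hyD⟩ := hy
  obtain ⟨Q, R, hQ, hR, hM⟩ := hu.exists_gevrey_bound hP hα₁.le hD
    fun k => by rw [← hyu]; exact hyD k t ht
  obtain ⟨K, hK, hrec⟩ := hP.exists_error_recursion
  -- The shift to `k + 1` lets `M k` dominate levels `k` and `k + 1` at once.
  set M : ℕ → ℝ := fun k => Q * R ^ (k + 1) * ((k + 1)! : ℝ) ^ α with hMdef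
  have hMk : ∀ k, ∀ x ∈ unitI, |P.powA k u x| ≤ M k ∧ |dx (P.powA k u) x| ≤ M k ∧
      |P.powA (k + 1) u x| ≤ M k ∧ |dx (P.powA (k + 1) u) x| ≤ M k := by
    intro k x hx
    have h1 := hM k x hx
    have h2 := hM (k + 1) x hx
    have h3 : Q * R ^ k * (k ! : ℝ) ^ α ≤ Q * R ^ (k + 1) * ((k + 1)! : ℝ) ^ α := by
      have : (k ! : ℝ) ≤ (k + 1)! := by exact_mod_cast Nat.factorial_le (Nat.le_succ k)
      have : R ^ k ≤ R ^ (k + 1) := pow_le_pow_right₀ hR (Nat.le_succ k)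
      gcongr
    have p1 := abs_nonneg (P.powA k u x)
    have p2 := abs_nonneg (dx (P.powA k u) x)
    have p3 := abs_nonneg (P.powA (k + 1) u x)
    have p4 := abs_nonneg (dx (P.powA (k + 1) u) x)
    simp only [hMdef]
    exact ⟨by linarith, by linarith, by linarith, by linarith⟩
  have hM0 : ∀ k, 0 ≤ M k := fun k => by positivity
  -- `16 = 4 * 4`: one factor from the factorial shift in `M`, one from `pow_mul_choose_le`.
  set s : ℕ → ℝ := fun m =>
    K * Q * R * ((K + 1) * R * 16) ^ m * (m ! : ℝ) ^ α / (2 * m)! with hs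
  have hsum : Summable s := by
    have := (summable_gevrey hα₂ (by positivity : 0 < (K + 1) * R * 16)).mul_left (K * Q * R)
    refine this.congr fun m => ?_
    simp only [hs]
    ring
  have hs0 : ∀ m, 0 ≤ s m := fun m => by positivity
  have hterm : ∀ m, K ^ (m + 1) * M m * (4 ^ m / (2 * m)!) ≤ s m := by
    intro m
    have h1 := factorial_succ_rpow_le hα₂.le m
    calc _ ≤ K * (K + 1) ^ m * (Q * R ^ (m + 1) * (4 ^ m * (m ! : ℝ) ^ α)) *
          (4 ^ m / (2 * m)!) := by
          rw [pow_succ' K]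
          have : K ^ m ≤ (K + 1) ^ m := by gcongr; linarith
          simp only [hMdef]
          gcongr
      _ = _ := by
          simp only [hs]
          rw [mul_pow, mul_pow, show (16 : ℝ) = 4 * 4 by norm_num, mul_pow]
          ring
  have hbound : ∀ᶠ n in atTop,
      norm2d (sample n u - P.flatState T y n t) ≤ step n * ∑' m, s m := by
    filter_upwards [hrec] with n hn
    have hh := step_pos n
    have hnh : (n : ℝ) * step n ≤ 1 := (node_mem (n := n) (i := n) (by omega)).2
    have hE := abs_le_sum_of_double_sum hK (n := n) (h := step n) (a := fun k => step n * M k)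
      (E := fun k j => P.powA k u ((j + 1) * step n) - P.flatDeriv T y n t k (j + 1))
      (fun k => mul_nonneg hh.le (hM0 k))
      (hn T t y (fun k => P.powA k u) M hT ht hyC hu.isH2 IsState.opA_ae_eq hu.left_powA
        hyu hMk)
    refine norm2d_le (mul_nonneg hh.le (tsum_nonneg hs0)) fun i => ?_
    have hEi := hE i i.2 0
    have e : (sample n u - P.flatState T y n t) i =
        P.powA 0 u ((i + 1) * step n) - P.flatDeriv T y n t 0 (i + 1) := by
      simp [sample, flatState, powA, flatDeriv]
    rw [e]
    refine hEi.trans ?_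
    calc _ ≤ ∑ m ∈ Finset.range n, step n * s m := by
          refine Finset.sum_le_sum fun m hm => ?_
          have hc := pow_mul_choose_le hh.le hnh i.2 (Finset.mem_range.1 hm)
          have := hM0 m
          rw [zero_add]
          calc _ ≤ K ^ (m + 1) * (step n * M m) * (4 ^ m / (2 * m)!) := by gcongr
            _ = step n * (K ^ (m + 1) * M m * (4 ^ m / (2 * m)!)) := by ring
            _ ≤ _ := by gcongr; exact hterm m
      _ ≤ _ := by
          rw [← Finset.mul_sum]
          gcongr
          exact hsum.sum_le_tsum _ fun m _ => hs0 m
  have hlim : Tendsto (fun n => step n * ∑' m, s m) atTop (𝓝 0) := by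
    simpa using tendsto_step.mul_const (∑' m, s m)
  refine squeeze_zero' (.of_forall fun n => ?_) hbound hlim
  unfold norm2d
  positivity

end Coeffs

end ParabolicFlat

theorem theorem4p3 (P : ParabolicFlat.Coeffs) (hP : P.Admissible)
    (T : ℝ) (hT : 0 < T) (u₀ uT : ℝ → ℝ) (hu₀ : P.IsState u₀) (huT : P.IsState uT)
    (α : ℝ) (hα₁ : 1 < α) (hα₂ : α < 2) (y : ℝ → ℝ) (hy : ParabolicFlat.IsGevrey α T y)
    (hy₀ : ∀ m : ℕ, iteratedDerivWithin m y (Set.Icc 0 T) 0 = P.endpointValue m u₀)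
    (hyT : ∀ m : ℕ, iteratedDerivWithin m y (Set.Icc 0 T) T = P.endpointValue m uT) :
    Filter.Tendsto
        (fun n : ℕ => ParabolicFlat.norm2d (ParabolicFlat.sample n u₀ - P.flatState T y n 0))
        Filter.atTop (nhds 0) ∧
      Filter.Tendsto
        (fun n : ℕ => ParabolicFlat.norm2d (ParabolicFlat.sample n uT - P.flatState T y n T))
        Filter.atTop (nhds 0) := by
  exact ⟨ParabolicFlat.Coeffs.tendsto_norm2d_sample_sub_flatState hP hu₀ hT
      ⟨le_rfl, hT.le⟩ hα₁ hα₂ hy hy₀,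
    ParabolicFlat.Coeffs.tendsto_norm2d_sample_sub_flatState hP huT hT
      ⟨hT.le, le_rfl⟩ hα₁ hα₂ hy hyT⟩
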